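/- Let $q$ be a prime power and $\alpha=0.08$. For odd $n$, let $(X_i)_{i\ge 0}$ be the Markov chain on $\{0,1,\dots,n\}$ with transition matrix \[P_n(d,r)=\mathbf 1(d+r\le n)\,q^{-(n-d-r)(n-r)}\frac{(q^{-(n-d)};q)_r\,(q^{-n};q)_r}{(q^{-r};q)_r},\qquad (x;q)_r=\prod_{i=0}^{r-1}(1-xq^i),\] (the chain of the rank increments of uniform random block lower bidiagonal matrices with $n\times n$ blocks over $\mathbb F_q$), and let \[Y_t=Y^{(n)}_t=X_{2\lfloor q^{n/2}(q-1)t\rfloor}-\tfrac n2\qquad(t\ge 0).\] Let $(Z^{\mathrm{odd}}_t)_{t\ge0}$ be the continuous time random walk on $\mathbb Z+\frac12$ which jumps from $a$ to $a+1$ with rate $q^{-a}$ and from $a$ to $a-1$ with rate $q^{a}$. Let $0=R_0<R_1<\cdots$ and $0=T_0<T_1<\cdots$ be the jump times of $Y$ and of $Z^{\mathrm{odd}}$, that is, $R_i=\inf\{t>R_{i-1}: Y_t\ne Y_{R_{i-1}}\}$ and $T_i=\inf\{t>T_{i-1}: Z^{\mathrm{odd}}_t\neq Z^{\mathrm{odd}}_{T_{i-1}}\}$,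 and let $\widehat Y_i=Y_{R_i}$, $\widehat Z^{\mathrm{odd}}_i=Z^{\mathrm{odd}}_{T_i}$. Theorem. There is a constant $C$ depending only on $q$ such that for every odd $n$ and every deterministic $a\in\mathbb Z+\frac12$ with $|a|\le 2\alpha n$ there is a coupling of the processes $Y=Y^{(n)}$ and $Z^{\mathrm{odd}}$, started from $Y_0=Z^{\mathrm{odd}}_0=a$, such that with probability at least $1-Cq^{-2\alpha n}$ all of the following hold: (a) for all $0\le i\le q^{2\alpha n}$, we have $\widehat Y_i=\widehat Z^{\mathrm{odd}}_i$; (b) for all $0\le i\le q^{2\alpha n}$, the times $R_i$ and $T_i$ are finite and $|R_i-T_i|\le q^{-\alpha n}$; (c) $T_{\lfloor q^{2\alpha n}\rfloor}\ge q^{\alpha n}$. -/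

import Mathlib

open MeasureTheory Set Filter Topology
open scoped NNReal ENNReal

noncomputable section

/-- The `q`-Pochhammer symbol `(a; q)_r = ∏_{i < r} (1 - a q^i)`. -/
def qPoch (a q : ℝ) (r : ℕ) : ℝ := ∏ i ∈ Finset.range r, (1 - a * q ^ i)

/-- The transition matrix of the rank increments, on the state space `{0, 1, …, n}`:
`P_n(d,r) = 1(d + r ≤ n) q^{-(n-d-r)(n-r)} (q^{-(n-d)};q)_r (q^{-n};q)_r / (q^{-r};q)_r`.
The exponents are formed in `ℤ`. -/
def rankP (q : ℝ) (n : ℕ) (d r : Fin (n + 1)) : ℝ :=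
  if (d : ℕ) + (r : ℕ) ≤ n then
    q ^ (-(((n : ℤ) - d - r) * ((n : ℤ) - r))) *
      (qPoch (q ^ (-((n : ℤ) - d))) q r * qPoch (q ^ (-(n : ℤ))) q r /
        qPoch (q ^ (-((r : ℕ) : ℤ))) q r)
  else 0

open Classical in
/-- `X` is a (discrete time, time homogeneous) Markov chain on the finite state space `S` with
transition matrix `P`, started from the deterministic state `a`. -/
structure IsDiscreteMarkovChain {Ω S : Type*} [MeasurableSpace Ω] [MeasurableSpace S] (μ : Measure Ω) (P : S → S → ℝ) (a : S) (X : ℕ → Ω → S) : Prop where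
  measurable : ∀ i, Measurable (X i)
  law : ∀ (k : ℕ) (x : ℕ → S),
    μ.real {ω | ∀ i ≤ k, X i ω = x i} =
      if x 0 = a then ∏ i ∈ Finset.range k, P (x i) (x (i + 1)) else 0

/-- The jump times of a path `f : [0, ∞) → S`: `T_0 = 0` and
`T_{i+1} = inf {t > T_i : f t ≠ f T_i}`, where `inf ∅ = ∞`.
(When `T_i = ∞`, the set is empty and `T_{i+1} = ∞`.) -/
def jumpTime {S : Type*} (f : ℝ≥0 → S) : ℕ → ℝ≥0∞
  | 0 => 0
  | i + 1 => sInf ((fun t : ℝ≥0 => (t : ℝ≥0∞)) ''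
      {t : ℝ≥0 | jumpTime f i < (t : ℝ≥0∞) ∧ f t ≠ f (jumpTime f i).toNNReal})

/-- The embedded sequence `f T_i` of a path, only meaningful when `T_i < ∞`. -/
def embedded {S : Type*} (f : ℝ≥0 → S) (i : ℕ) : S := f (jumpTime f i).toNNReal

open Classical in
/-- `Z` is a continuous time random walk (continuous time Markov chain) on the countable state
space `S` with transition rate matrix `Q`, started from the deterministic state `a`, described
through its jump chain and holding times. It is meant for rate matrices whose diagonal entries are
all negative and which are non-explosive.
The paths are almost surely right-continuous step functions with finitely many jumps on every
bounded interval; the embedded chain is a Markov chain with transition probabilities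
`Q x y / (-Q x x)` for `x ≠ y`, and, given the embedded chain, the holding times `T_{i+1} - T_i`
are independent and exponentially distributed with parameters `-Q (x i) (x i)`. -/
structure IsMarkovJumpProcess {Ω S : Type*} [MeasurableSpace Ω] [MeasurableSpace S] (μ : Measure Ω) (Q : S → S → ℝ) (a : S) (Z : ℝ≥0 → Ω → S) : Prop where
  measurable : ∀ t, Measurable (Z t)
  right_continuous : ∀ᵐ ω ∂μ, ∀ t : ℝ≥0, ∀ᶠ s in 𝓝[>] t, Z s ω = Z t ω
  non_explosive : ∀ᵐ ω ∂μ, Tendsto (jumpTime fun t => Z t ω) atTop (𝓝 ∞)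
  law : ∀ (k : ℕ) (x : ℕ → S) (h : ℕ → ℝ≥0),
    μ.real {ω | (∀ i ≤ k, embedded (fun t => Z t ω) i = x i) ∧
        ∀ i < k, jumpTime (fun t => Z t ω) i + (h i : ℝ≥0∞) < jumpTime (fun t => Z t ω) (i + 1)} =
      if x 0 = a then
        ∏ i ∈ Finset.range k,
          (if x i = x (i + 1) then 0 else Q (x i) (x (i + 1)) / (-Q (x i) (x i))) *
            Real.exp (Q (x i) (x i) * h i)
      else 0

/-- The state space `ℤ + 1/2`. -/
abbrev HalfInt : Type := {x : ℝ // ∃ k : ℤ, x = (k : ℝ) + 1 / 2}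

open Classical in
/-- The transition rate matrix of the walk on `ℤ + 1/2`: up with rate `q^{-a}`, down with rate
`q^a`. -/
def oddRate (q : ℝ) (a b : HalfInt) : ℝ :=
  if (b : ℝ) = (a : ℝ) + 1 then q ^ (-(a : ℝ))
  else if (b : ℝ) = (a : ℝ) - 1 then q ^ (a : ℝ)
  else if a = b then -q ^ (a : ℝ) - q ^ (-(a : ℝ))
  else 0

/-- The rescaled and recentered path `Y_t = X(2 ⌊q^{n/2} (q - 1) t⌋) - n/2`. -/
def rescaled (q : ℝ) (n : ℕ) (X : ℕ → Fin (n + 1)) (t : ℝ≥0) : ℝ :=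
  ((X (2 * ⌊q ^ ((n : ℝ) / 2) * (q - 1) * (t : ℝ)⌋₊) : ℕ) : ℝ) - (n : ℝ) / 2

end

/-! A step of the chain from `d` has the law of the rank of a uniform `(n-d) × n` matrix. It almost
always leads to `n-d`, so two steps almost always lead back to `d`. At height `z = d - n/2`, two
steps lead to `d+1` with probability about `δ q^{-z}` and to `d-1` with probability about `δ q^z`,
where `δ = q^{-n/2}/(q-1)` (`cellLen`) is the rescaled duration of two steps. The chain at even
times is thus a discretization of the walk on `ℤ + 1/2` with mesh `δ`.

Put `B = 2αn`, `λ(z) = q^z + q^{-z}`, `s = 1 - δ λ(z)` and `η = failProb`. For `|z| ≤ B` and `η ≤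
1`, the lower bounds `le_rankP₂_self`, `le_rankP₂_succ` and `le_rankP₂_pred` show that the two step
matrix dominates, entry by entry, `s` times the identity plus `(1-s)(1-η)` times the jump law of the
walk. What is left over, normalized, is a probability law (`residualJump`), so upper bounds on the
matrix are never needed.

Both processes read the same i.i.d. instructions. One uniform `u` yields the exponential holding
time `-log u / λ` of the walk and a geometric holding time of the chain: the chain stays while `u <
s`, replacing `u` by `u/s`, which is again uniform. The two differ by at most `δ (1 - log u)`
(`abs_geom_sub_exp_le`). A second uniform gives the direction; a third decides whether the chain
follows it or uses the residual law. `walkKernel_rankJump` checks that the even-time chain gets the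
right transition matrix, and `exists_bridge` fills in the odd times by conditional sampling.

A jump is bad if `u` is tiny, if the residual law is used, or if the walk leaves `[-B, B]`. A union
bound over `q^B` jumps (`measure_failSet_le`) gives `O(q^{-B})`; this needs `3B ≤ n/2`, which `α =
0.08` allows. Off the bad event the jump chains agree and the time errors add up
(`rescaled_jumpTime`).

Non-explosion and the lower bound (c) both come from the Lyapunov function `q^{|x|/2}`: the
expectation of `exp(-T_N) q^{|Z_N|/2}` decays like `(1 - gap)^N` (`halfStep_lyapunov`,
`measure_jtime_lt_le`). -/

/-! ### Rank distribution of uniform matrices -/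

/-- The probability that a uniform random `m × n` matrix over the field with `q` elements has
rank `r`. -/
noncomputable def rankF (q : ℝ) (n m r : ℕ) : ℝ :=
  q ^ (-(((m : ℤ) - r) * ((n : ℤ) - r))) *
    (qPoch (q ^ (-(m : ℤ))) q r * qPoch (q ^ (-(n : ℤ))) q r / qPoch (q ^ (-(r : ℤ))) q r)

lemma qPoch_succ (a q : ℝ) (r : ℕ) : qPoch a q (r + 1) = qPoch a q r * (1 - a * q ^ r) := by
  simp [qPoch, Finset.prod_range_succ]

lemma qPoch_succ' (q : ℝ) (hq : q ≠ 0) (m r : ℕ) :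
    qPoch (q ^ (-((m + 1 : ℕ) : ℤ))) q (r + 1) =
      (1 - q ^ (-((m + 1 : ℕ) : ℤ))) * qPoch (q ^ (-(m : ℤ))) q r := by
  unfold qPoch
  rw [Finset.prod_range_succ', mul_comm]
  congr 1
  · simp
  · refine Finset.prod_congr rfl fun i _ => ?_
    congr 1
    rw [← zpow_natCast, ← zpow_natCast, ← zpow_add₀ hq, ← zpow_add₀ hq]
    congr 1
    push_cast
    ring

lemma qPoch_eq_zero (q : ℝ) (hq : q ≠ 0) {m r : ℕ} (h : m < r) :
    qPoch (q ^ (-(m : ℤ))) q r = 0 := by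
  unfold qPoch
  refine Finset.prod_eq_zero (Finset.mem_range.2 h) ?_
  rw [← zpow_natCast, ← zpow_add₀ hq]
  simp

lemma qPoch_self_pos {q : ℝ} (hq : 1 < q) (r : ℕ) : 0 < qPoch (q ^ (-(r : ℤ))) q r := by
  unfold qPoch
  refine Finset.prod_pos fun i hi => ?_
  have hi := Finset.mem_range.1 hi
  rw [← zpow_natCast, ← zpow_add₀ (by positivity), sub_pos]
  exact zpow_lt_one_of_neg₀ hq (by omega)

lemma rankF_eq_zero (q : ℝ) (hq : q ≠ 0) (n : ℕ) {m r : ℕ} (h : m < r) : rankF q n m r = 0 := by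
  rw [rankF, qPoch_eq_zero q hq h, zero_mul, zero_div, mul_zero]

lemma rankP_eq_rankF {q : ℝ} (hq : q ≠ 0) (n : ℕ) (d r : Fin (n + 1)) :
    rankP q n d r = rankF q n (n - d) r := by
  have hd : (d : ℕ) ≤ n := by omega
  unfold rankP
  split_ifs with h
  · simp only [rankF]
    push_cast [Nat.cast_sub hd]
    rfl
  · rw [rankF_eq_zero q hq]
    omega

lemma rankF_succ_zero {q : ℝ} (hq : q ≠ 0) (n m : ℕ) :
    rankF q n (m + 1) 0 = rankF q n m 0 * q ^ (-(n : ℤ)) := by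
  simp only [rankF, qPoch, Finset.range_zero, Finset.prod_empty]
  norm_num
  rw [← zpow_natCast, ← zpow_neg, ← zpow_neg, ← zpow_neg, ← zpow_add₀ hq]
  congr 1
  ring

/-- Appending a row: a uniform vector lies in a row space of dimension `r` with probability
`q^{-(n-r)}`. This recursion replaces any counting of matrices; nonnegativity and total mass one
follow from it by induction on `m`. -/
lemma rankF_succ_succ {q : ℝ} (hq : 1 < q) (n m r : ℕ) :
    rankF q n (m + 1) (r + 1) =
      rankF q n m (r + 1) * q ^ (-((n : ℤ) - (r + 1))) +
        rankF q n m r * (1 - q ^ (-((n : ℤ) - r))) := by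
  have h0 : q ≠ 0 := by positivity
  have hC := (qPoch_self_pos hq r).ne'
  have hb : (1 - q ^ (-((r + 1 : ℕ) : ℤ))) ≠ 0 := by
    have := zpow_lt_one_of_neg₀ hq (show (-((r + 1 : ℕ) : ℤ)) < 0 by omega)
    linarith
  have hm : q ^ (-((m + 1 : ℕ) : ℤ)) = q ^ (-((m : ℤ) - r)) * q ^ (-((r + 1 : ℕ) : ℤ)) := by
    rw [← zpow_add₀ h0]; congr 1; push_cast; ring
  have h1 : q ^ (-(m : ℤ)) * q ^ r = q ^ (-((m : ℤ) - r)) := by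
    rw [← zpow_natCast, ← zpow_add₀ h0]; congr 1; ring
  have h2 : q ^ (-(n : ℤ)) * q ^ r = q ^ (-((n : ℤ) - r)) := by
    rw [← zpow_natCast, ← zpow_add₀ h0]; congr 1; ring
  -- All quadratic exponents are reduced to a single common power, which leaves an identity of
  -- rational functions.
  have e1 : q ^ (-((((m + 1 : ℕ) : ℤ) - (r + 1 : ℕ)) * ((n : ℤ) - (r + 1 : ℕ)))) =
      q ^ (-((m : ℤ) - (r + 1 : ℕ)) * ((n : ℤ) - (r + 1 : ℕ))) * q ^ (-((n : ℤ) - (r + 1))) := by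
    rw [← zpow_add₀ h0]; congr 1; push_cast; ring
  have e3 : q ^ (-(((m : ℤ) - r) * ((n : ℤ) - r))) =
      q ^ (-((m : ℤ) - (r + 1 : ℕ)) * ((n : ℤ) - (r + 1 : ℕ))) * q ^ (-((n : ℤ) - (r + 1))) *
        q ^ (-((m : ℤ) - r)) := by
    rw [← zpow_add₀ h0, ← zpow_add₀ h0]; congr 1; push_cast; ring
  simp only [rankF]
  rw [qPoch_succ' q h0 m r, qPoch_succ' q h0 r r, qPoch_succ (q ^ (-(n : ℤ))),
    qPoch_succ (q ^ (-(m : ℤ))), h1, h2, e1, e3, hm, ← neg_mul]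
  generalize qPoch (q ^ (-(r : ℤ))) q r = C at *
  generalize q ^ (-((r + 1 : ℕ) : ℤ)) = b at *
  generalize q ^ (-((m : ℤ) - r)) = a at *
  field_simp
  ring

lemma rankF_nonneg {q : ℝ} (hq : 1 < q) (n : ℕ) : ∀ m r : ℕ, r ≤ n → 0 ≤ rankF q n m r := by
  have h0 : 0 < q := by positivity
  intro m
  induction m with
  | zero =>
    intro r _
    rcases r with _ | r
    · simp [rankF, qPoch]
    · rw [rankF_eq_zero q h0.ne' n (Nat.succ_pos r)]
  | succ m ih =>
    intro r hr
    rcases r with _ | r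
    · rw [rankF_succ_zero h0.ne']
      exact mul_nonneg (ih _ hr) (by positivity)
    · rw [rankF_succ_succ hq]
      have := zpow_le_one_of_nonpos₀ hq.le (show (-((n : ℤ) - r)) ≤ 0 by omega)
      exact add_nonneg (mul_nonneg (ih _ hr) (by positivity))
        (mul_nonneg (ih _ (by omega)) (by linarith))

lemma sum_rankF {q : ℝ} (hq : 1 < q) (n m : ℕ) :
    ∑ r ∈ Finset.range (n + 1), rankF q n m r = 1 := by
  have h0 : 0 < q := by positivity
  induction m with
  | zero =>
    rw [Finset.sum_range_succ', Finset.sum_eq_zero fun r _ =>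
      rankF_eq_zero q h0.ne' n (Nat.succ_pos r)]
    simp [rankF, qPoch]
  | succ m ih =>
    rw [Finset.sum_range_succ', rankF_succ_zero h0.ne']
    simp only [rankF_succ_succ hq]
    rw [Finset.sum_add_distrib]
    have h1 := Finset.sum_range_succ' (fun r => rankF q n m r * q ^ (-((n : ℤ) - r))) n
    have h2 := Finset.sum_range_succ (fun r => rankF q n m r * (1 - q ^ (-((n : ℤ) - r)))) n
    simp only [Nat.cast_zero, sub_zero, sub_self, neg_zero, zpow_zero, mul_zero, add_zero,
      Nat.cast_add, Nat.cast_one] at h1 h2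
    rw [add_right_comm, ← h1, ← h2, ← Finset.sum_add_distrib]
    refine (Finset.sum_congr rfl fun r _ => ?_).trans ih
    ring

lemma rankF_self_succ {q : ℝ} (hq : 1 < q) (n m : ℕ) :
    rankF q n (m + 1) (m + 1) = rankF q n m m * (1 - q ^ (-((n : ℤ) - m))) := by
  rw [rankF_succ_succ hq, rankF_eq_zero q (by positivity) n (Nat.lt_succ_self m)]
  ring

/-- Full rank has probability `∏_{i<m} (1 - q^{i-n})`; the bound subtracts the geometric series of
the `q^{i-n}`. -/
lemma le_rankF_self {q : ℝ} (hq : 1 < q) (n m : ℕ) (hm : m ≤ n) :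
    1 - q ^ (-((n : ℤ) - m)) / (q - 1) ≤ rankF q n m m := by
  have h0 : 0 < q := by positivity
  have h1 : 0 < q - 1 := by linarith
  induction m with
  | zero =>
    have : 0 ≤ q ^ (-((n : ℤ) - (0 : ℕ))) / (q - 1) := by positivity
    simp only [rankF, qPoch] at *
    simp at *
    linarith
  | succ m ih =>
    have ih := ih (by omega)
    rw [rankF_self_succ hq]
    have e : q ^ (-((n : ℤ) - (m + 1 : ℕ))) = q ^ (-((n : ℤ) - m)) * q := by
      rw [← zpow_add_one₀ h0.ne']; congr 1; push_cast; ring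
    have hx : 0 < q ^ (-((n : ℤ) - m)) := by positivity
    -- With `x = q^{-(n-m)}` and a factor at most 1, multiplying by `1 - x` costs at most `x`, and
    -- `x q/(q-1) = x/(q-1) + x` closes the induction exactly.
    have hle : rankF q n m m ≤ 1 := by
      rw [← sum_rankF hq n m]
      exact Finset.single_le_sum (f := fun r => rankF q n m r)
        (fun r hr => rankF_nonneg hq n m r (by simp at hr; omega)) (by simp; omega)
    rw [e]
    have e2 : q ^ (-((n : ℤ) - m)) * q / (q - 1) =
        q ^ (-((n : ℤ) - m)) / (q - 1) + q ^ (-((n : ℤ) - m)) := by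
      field_simp
      ring
    rw [e2]
    nlinarith

lemma qPoch_succ_self {q : ℝ} (hq : 1 < q) (m : ℕ) :
    qPoch (q ^ (-((m + 1 : ℕ) : ℤ))) q m * (1 - q⁻¹) =
      (1 - q ^ (-((m + 1 : ℕ) : ℤ))) * qPoch (q ^ (-(m : ℤ))) q m := by
  have h0 : q ≠ 0 := by positivity
  rw [← qPoch_succ' q h0, qPoch_succ]
  congr 2
  rw [← zpow_natCast, ← zpow_add₀ h0, ← zpow_neg_one]
  congr 1
  push_cast
  ring

/-- Corank one. The leading factor `q^{-(n-m-1)}/(q-1)` is the source of the jump rates of the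
limiting walk. -/
lemma rankF_succ_self {q : ℝ} (hq : 1 < q) (n m : ℕ) :
    rankF q n (m + 1) m =
      q ^ (-((n : ℤ) - (m + 1))) / (q - 1) * (1 - q ^ (-((m : ℤ) + 1))) * rankF q n m m := by
  have h0 : q ≠ 0 := by positivity
  have h1 : q - 1 ≠ 0 := by linarith
  have hC := (qPoch_self_pos hq m).ne'
  have h := qPoch_succ_self hq m
  have e : q ^ (-((n : ℤ) - (m + 1))) = q ^ (-((n : ℤ) - m)) * q := by
    rw [← zpow_add_one₀ h0]; congr 1; ring
  have h2 : 1 - q⁻¹ ≠ 0 := by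
    have := inv_lt_one_of_one_lt₀ hq
    linarith
  rw [← eq_div_iff h2] at h
  simp only [rankF]
  rw [h, e]
  push_cast
  simp only [sub_self, zero_mul, neg_zero, zpow_zero, add_sub_cancel_left, one_mul]
  field_simp

lemma rankP_nonneg {q : ℝ} (hq : 1 < q) (n : ℕ) (d r : Fin (n + 1)) : 0 ≤ rankP q n d r := by
  rw [rankP_eq_rankF (by positivity)]
  exact rankF_nonneg hq n _ _ (by omega)

lemma sum_rankP {q : ℝ} (hq : 1 < q) (n : ℕ) (d : Fin (n + 1)) : ∑ r, rankP q n d r = 1 := by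
  simp only [rankP_eq_rankF (show q ≠ 0 by positivity)]
  rw [← sum_rankF hq n (n - d), ← Fin.sum_univ_eq_sum_range]

lemma le_rankP_rev {q : ℝ} (hq : 1 < q) (n : ℕ) (d r : Fin (n + 1)) (h : (d : ℕ) + r = n) :
    1 - q ^ (-(d : ℝ)) / (q - 1) ≤ rankP q n d r := by
  have := le_rankF_self hq n (n - d) (by omega)
  rw [rankP_eq_rankF (by positivity), show (r : ℕ) = n - d by omega]
  convert this using 3
  rw [← Real.rpow_intCast]
  congr 1
  push_cast [Nat.cast_sub (show (d : ℕ) ≤ n by omega)]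
  ring

lemma le_rankP_rev_pred {q : ℝ} (hq : 2 ≤ q) (n : ℕ) (d r : Fin (n + 1))
    (h : (d : ℕ) + r + 1 = n) :
    q ^ (-(d : ℝ)) / (q - 1) * (1 - q ^ (-((n : ℝ) - d)) - q ^ (-(d : ℝ))) ≤ rankP q n d r := by
  have h0 : 0 < q := by positivity
  have h1 : 0 < q - 1 := by linarith
  have := le_rankF_self (show 1 < q by linarith) n r (by omega)
  rw [rankP_eq_rankF (by positivity), show n - (d : ℕ) = r + 1 by omega,
    rankF_succ_self (by linarith)]
  have hn : (n : ℤ) = d + r + 1 := by omega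
  have hn' : (n : ℝ) = d + r + 1 := by exact_mod_cast hn
  rw [show -((n : ℤ) - r) = -(d : ℤ) - 1 by omega, zpow_sub_one₀ h0.ne'] at this
  rw [show -((n : ℤ) - (r + 1)) = -(d : ℤ) by omega,
    show -((n : ℝ) - d) = ((-((r : ℤ) + 1) : ℤ) : ℝ) by push_cast; linarith,
    show -(d : ℝ) = ((-(d : ℤ) : ℤ) : ℝ) by push_cast; rfl, Real.rpow_intCast, Real.rpow_intCast,
    mul_assoc]
  have hd : 0 < q ^ (-(d : ℤ)) := by positivity
  have hr : 0 < q ^ (-((r : ℤ) + 1)) := by positivity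
  have hr1 : q ^ (-((r : ℤ) + 1)) ≤ 1 := zpow_le_one_of_nonpos₀ (by linarith) (by omega)
  refine mul_le_mul_of_nonneg_left ?_ (by positivity)
  have h2 : q ^ (-(d : ℤ)) * q⁻¹ / (q - 1) ≤ q ^ (-(d : ℤ)) := by
    rw [mul_div_assoc]
    refine mul_le_of_le_one_right hd.le ?_
    rw [div_le_one h1]
    exact (inv_le_one_of_one_le₀ (by linarith)).trans (by linarith)
  nlinarith

/-! ### Lower bounds for two steps of the chain -/

/-- The two step transition matrix of the rank increments. -/
noncomputable def rankP₂ (q : ℝ) (n : ℕ) (d x : Fin (n + 1)) : ℝ :=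
  ∑ y, rankP q n d y * rankP q n y x

lemma mul_le_rankP₂ {q : ℝ} (hq : 1 < q) (n : ℕ) (d y x : Fin (n + 1)) :
    rankP q n d y * rankP q n y x ≤ rankP₂ q n d x :=
  Finset.single_le_sum (f := fun y => rankP q n d y * rankP q n y x)
    (fun y _ => mul_nonneg (rankP_nonneg hq n d y) (rankP_nonneg hq n y x)) (Finset.mem_univ y)

lemma rankP₂_nonneg {q : ℝ} (hq : 1 < q) (n : ℕ) (d x : Fin (n + 1)) : 0 ≤ rankP₂ q n d x :=
  Finset.sum_nonneg fun y _ => mul_nonneg (rankP_nonneg hq n d y) (rankP_nonneg hq n y x)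

lemma sum_rankP₂ {q : ℝ} (hq : 1 < q) (n : ℕ) (d : Fin (n + 1)) : ∑ x, rankP₂ q n d x = 1 := by
  simp only [rankP₂]
  rw [Finset.sum_comm]
  simp only [← Finset.mul_sum, sum_rankP hq, mul_one]

section Zone

variable {q : ℝ} {n : ℕ} {B z : ℝ} {d : Fin (n + 1)}

lemma rpow_neg_eq_mul (hq : 2 ≤ q) (hz : (d : ℝ) = n / 2 + z) :
    q ^ (-(d : ℝ)) = q ^ (-(n : ℝ) / 2) * q ^ (-z) := by
  rw [← Real.rpow_add (by linarith), hz]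
  ring_nf

lemma rpow_neg_sub_eq_mul (hq : 2 ≤ q) (hz : (d : ℝ) = n / 2 + z) :
    q ^ (-((n : ℝ) - d)) = q ^ (-(n : ℝ) / 2) * q ^ z := by
  rw [← Real.rpow_add (by linarith), hz]
  ring_nf

lemma le_rankP₂_self (hq : 2 ≤ q) (hz : (d : ℝ) = n / 2 + z) :
    1 - q ^ (-(n : ℝ) / 2) / (q - 1) * (q ^ z + q ^ (-z)) ≤ rankP₂ q n d d := by
  have h1 : 0 < q - 1 := by linarith
  have hd : (d : ℕ) ≤ n := by omega
  -- The dominant path is `d → n-d → d`, with full rank at both steps.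
  set y : Fin (n + 1) := ⟨n - d, by omega⟩ with hy
  have hyv : (y : ℝ) = n - d := by simp [hy, Nat.cast_sub hd]
  have a1 := le_rankP_rev (by linarith) n d y (q := q) (by simp [hy]; omega)
  have a2 := le_rankP_rev (by linarith) n y d (q := q) (by simp [hy]; omega)
  refine le_trans ?_ (mul_le_rankP₂ (by linarith) n d y d)
  rw [hyv, rpow_neg_sub_eq_mul hq hz] at a2
  rw [rpow_neg_eq_mul hq hz] at a1
  have b1 : rankP q n d y ≤ 1 := by
    rw [← sum_rankP (show 1 < q by linarith) n d]
    exact Finset.single_le_sum (f := fun y => rankP q n d y)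
      (fun y _ => rankP_nonneg (by linarith) n d y) (Finset.mem_univ y)
  have b2 : rankP q n y d ≤ 1 := by
    rw [← sum_rankP (show 1 < q by linarith) n y]
    exact Finset.single_le_sum (f := fun d => rankP q n y d)
      (fun d _ => rankP_nonneg (by linarith) n y d) (Finset.mem_univ d)
  rw [mul_div_right_comm] at a1 a2
  nlinarith

lemma le_rankP₂_succ (hq : 2 ≤ q) (hz : (d : ℝ) = n / 2 + z) (hB : |z| ≤ B)
    (hB1 : 3 * q * q ^ (-(n : ℝ) / 2 + B) ≤ 1) {x : Fin (n + 1)} (hx : (x : ℕ) = d + 1) :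
    q ^ (-(n : ℝ) / 2) / (q - 1) * q ^ (-z) * (1 - 3 * q * q ^ (-(n : ℝ) / 2 + B)) ≤
      rankP₂ q n d x := by
  have h0 : 0 < q := by linarith
  have h1 : 0 < q - 1 := by linarith
  -- The path `d → n-d-1 → d+1`: corank one, then full rank.
  set y : Fin (n + 1) := ⟨n - d - 1, by omega⟩ with hy
  have hyv : (y : ℝ) = n - d - 1 := by
    have : (y : ℕ) + d + 1 = n := by simp [hy]; omega
    have : (y : ℝ) + d + 1 = n := by exact_mod_cast this
    linarith
  have a1 := le_rankP_rev_pred hq n d y (by simp [hy]; omega)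
  have a2 := le_rankP_rev (by linarith) n y x (q := q) (by simp [hy]; omega)
  refine le_trans ?_ (mul_le_rankP₂ (by linarith) n d y x)
  rw [hyv, show -((n : ℝ) - d - 1) = -((n : ℝ) - d) + 1 by ring, Real.rpow_add_one h0.ne'] at a2
  rw [rpow_neg_sub_eq_mul hq hz] at a1 a2
  rw [rpow_neg_eq_mul hq hz] at a1
  have k1 : q ^ (-(n : ℝ) / 2) * q ^ z ≤ q ^ (-(n : ℝ) / 2 + B) := by
    rw [← Real.rpow_add h0]
    exact Real.rpow_le_rpow_of_exponent_le (by linarith) (by linarith [le_abs_self z])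
  have k2 : q ^ (-(n : ℝ) / 2) * q ^ (-z) ≤ q ^ (-(n : ℝ) / 2 + B) := by
    rw [← Real.rpow_add h0]
    exact Real.rpow_le_rpow_of_exponent_le (by linarith) (by linarith [neg_le_abs z])
  have k0 : 0 < q ^ (-(n : ℝ) / 2 + B) := by positivity
  have k3 : q ^ (-(n : ℝ) / 2) * q ^ z * q / (q - 1) ≤ q * q ^ (-(n : ℝ) / 2 + B) := by
    rw [div_le_iff₀ h1, mul_comm _ q, mul_assoc]
    refine mul_le_mul_of_nonneg_left (k1.trans ?_) h0.le
    nlinarith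
  rw [mul_div_right_comm] at a1
  have k4 : 0 < q ^ (-(n : ℝ) / 2) / (q - 1) * q ^ (-z) := by positivity
  set κ := q ^ (-(n : ℝ) / 2 + B)
  set e := q ^ (-(n : ℝ) / 2) / (q - 1) * q ^ (-z)
  have c1 : e * (1 - 2 * κ) ≤ rankP q n d y :=
    le_trans (mul_le_mul_of_nonneg_left (by linarith) k4.le) a1
  have c2 : 1 - q * κ ≤ rankP q n y x := by linarith
  have hqκ : 2 * κ ≤ q * κ := by nlinarith
  refine le_trans ?_ (mul_le_mul c1 c2 (by nlinarith) (rankP_nonneg (by linarith) n d y))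
  rw [mul_assoc e]
  refine mul_le_mul_of_nonneg_left ?_ k4.le
  nlinarith

lemma le_rankP₂_pred (hq : 2 ≤ q) (hz : (d : ℝ) = n / 2 + z) (hB : |z| ≤ B)
    (hB1 : 3 * q * q ^ (-(n : ℝ) / 2 + B) ≤ 1) {x : Fin (n + 1)} (hx : (x : ℕ) + 1 = d) :
    q ^ (-(n : ℝ) / 2) / (q - 1) * q ^ z * (1 - 3 * q * q ^ (-(n : ℝ) / 2 + B)) ≤
      rankP₂ q n d x := by
  have h0 : 0 < q := by linarith
  have h1 : 0 < q - 1 := by linarith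
  -- The path `d → n-d → d-1`: full rank, then corank one.
  set y : Fin (n + 1) := ⟨n - d, by omega⟩ with hy
  have hyv : (y : ℝ) = n - d := by
    have : (y : ℕ) + d = n := by simp [hy]; omega
    have : (y : ℝ) + d = n := by exact_mod_cast this
    linarith
  have a1 := le_rankP_rev (by linarith) n d y (q := q) (by simp [hy]; omega)
  have a2 := le_rankP_rev_pred hq n y x (by simp [hy]; omega)
  refine le_trans ?_ (mul_le_rankP₂ (by linarith) n d y x)
  rw [hyv, sub_sub_cancel] at a2
  rw [rpow_neg_sub_eq_mul hq hz, rpow_neg_eq_mul hq hz] at a2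
  rw [rpow_neg_eq_mul hq hz] at a1
  have k1 : q ^ (-(n : ℝ) / 2) * q ^ z ≤ q ^ (-(n : ℝ) / 2 + B) := by
    rw [← Real.rpow_add h0]
    exact Real.rpow_le_rpow_of_exponent_le (by linarith) (by linarith [le_abs_self z])
  have k2 : q ^ (-(n : ℝ) / 2) * q ^ (-z) ≤ q ^ (-(n : ℝ) / 2 + B) := by
    rw [← Real.rpow_add h0]
    exact Real.rpow_le_rpow_of_exponent_le (by linarith) (by linarith [neg_le_abs z])
  have k0 : 0 < q ^ (-(n : ℝ) / 2 + B) := by positivity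
  have k5 : 0 < q ^ (-(n : ℝ) / 2) * q ^ (-z) := by positivity
  have k3 : q ^ (-(n : ℝ) / 2) * q ^ (-z) / (q - 1) ≤ q ^ (-(n : ℝ) / 2 + B) := by
    rw [div_le_iff₀ h1]
    nlinarith
  rw [mul_div_right_comm] at a2
  have k4 : 0 < q ^ (-(n : ℝ) / 2) / (q - 1) * q ^ z := by positivity
  set κ := q ^ (-(n : ℝ) / 2 + B)
  set e := q ^ (-(n : ℝ) / 2) / (q - 1) * q ^ z
  have c1 : e * (1 - 2 * κ) ≤ rankP q n y x :=
    le_trans (mul_le_mul_of_nonneg_left (by linarith) k4.le) a2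
  have c2 : 1 - κ ≤ rankP q n d y := by linarith
  have hqκ : 2 * κ ≤ q * κ := by nlinarith
  refine le_trans ?_ (mul_le_mul c2 c1 (mul_nonneg k4.le (by nlinarith))
    (rankP_nonneg (by linarith) n d y))
  rw [mul_left_comm]
  refine mul_le_mul_of_nonneg_left ?_ k4.le
  nlinarith

end Zone

/-! ### Markov chains driven by i.i.d. instructions -/

/-- The uniform distribution on the unit interval. -/
noncomputable def unif : Measure ℝ := volume.restrict (Ioo 0 1)

instance : IsProbabilityMeasure unif := ⟨by simp [unif]⟩

lemma ae_unif : ∀ᵐ u ∂unif, u ∈ Ioo (0 : ℝ) 1 := ae_restrict_mem measurableSet_Ioo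

lemma unif_Iio {x : ℝ} (h1 : x ≤ 1) : unif (Iio x) = ENNReal.ofReal x := by
  rw [unif, Measure.restrict_apply measurableSet_Iio,
    show Iio x ∩ Ioo 0 1 = Ioo 0 x by ext; simp; constructor <;> intro h <;> grind]
  simp

lemma unif_Ici {x : ℝ} (h0 : 0 ≤ x) (h1 : x ≤ 1) : unif (Ici x) = ENNReal.ofReal (1 - x) := by
  rw [← compl_Iio, prob_compl_eq_one_sub measurableSet_Iio, unif_Iio h1, ENNReal.ofReal_sub _ h0,
    ENNReal.ofReal_one]

/-- Conditionally on `u < s`, the variable `u/s` is uniform again. This lets one uniform variable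
serve a whole geometric waiting time. -/
lemma lintegral_unif_scale {s : ℝ} (h0 : 0 ≤ s) (h1 : s ≤ 1) {F : ℝ → ℝ≥0∞} (hF : Measurable F) :
    ∫⁻ u, (Iio s).indicator (fun u => F (u / s)) u ∂unif =
      ENNReal.ofReal s * ∫⁻ u, F u ∂unif := by
  rcases h0.eq_or_lt with rfl | hs
  · simp only [ENNReal.ofReal_zero, zero_mul]
    refine lintegral_eq_zero_of_ae_eq_zero ?_
    filter_upwards [ae_unif] with u hu
    simp [hu.1.le]
  · have e1 : ∀ u, (Ioo (0 : ℝ) 1).indicator ((Iio s).indicator (fun u => F (u / s))) u =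
        (Ioo (0 : ℝ) 1).indicator F (u * s⁻¹) := by
      intro u
      have : u ∈ Ioo 0 1 ∧ u ∈ Iio s ↔ u * s⁻¹ ∈ Ioo 0 1 := by
        simp only [← div_eq_mul_inv, mem_Ioo, mem_Iio, div_lt_one hs, div_pos_iff_of_pos_right hs]
        constructor <;> intro h <;> grind
      by_cases hu : u * s⁻¹ ∈ Ioo (0 : ℝ) 1
      · rw [indicator_of_mem hu, indicator_of_mem (this.2 hu).1, indicator_of_mem (this.2 hu).2,
          div_eq_mul_inv]
      · rw [indicator_of_notMem hu]
        by_cases h1 : u ∈ Ioo (0 : ℝ) 1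
        · rw [indicator_of_mem h1, indicator_of_notMem fun h2 => hu (this.1 ⟨h1, h2⟩)]
        · rw [indicator_of_notMem h1]
    have hG : Measurable ((Ioo (0 : ℝ) 1).indicator F) := hF.indicator measurableSet_Ioo
    rw [unif, ← lintegral_indicator measurableSet_Ioo, ← lintegral_indicator measurableSet_Ioo]
    simp only [e1]
    rw [← lintegral_map (μ := volume) hG (measurable_mul_const s⁻¹),
      Real.map_volume_mul_right (inv_ne_zero hs.ne'), lintegral_smul_measure]
    simp [abs_of_pos hs]

lemma measurePreserving_head_tail {E : Type*} [MeasurableSpace E] (ν : Measure E)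
    [IsProbabilityMeasure ν] :
    MeasurePreserving (fun ω : ℕ → E => (ω 0, fun i => ω (i + 1)))
      (Measure.infinitePi fun _ => ν) (ν.prod (Measure.infinitePi fun _ => ν)) := by
  classical
  -- The inverse map, prepending an entry, is handled first: its image measure is recognized as the
  -- product measure on boxes.
  let c : E × (ℕ → E) → (ℕ → E) := fun p i => Nat.casesOn i p.1 p.2
  have hc : Measurable c := by
    refine measurable_pi_iff.2 fun i => ?_
    cases i with
    | zero => exact measurable_fst
    | succ i => exact (measurable_pi_apply i).comp measurable_snd
  have hm : Measurable (fun ω : ℕ → E => (ω 0, fun i => ω (i + 1))) := by fun_prop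
  have key : (ν.prod (Measure.infinitePi fun _ => ν)).map c = Measure.infinitePi fun _ => ν := by
    refine Measure.eq_infinitePi _ fun s t ht => ?_
    rw [Measure.map_apply hc (MeasurableSet.pi s.countable_toSet fun i _ => ht i)]
    have e : c ⁻¹' (Set.pi s t) = (if 0 ∈ s then t 0 else univ) ×ˢ
        Set.pi ↑(s.preimage Nat.succ (Nat.succ_injective.injOn)) (fun i => t (i + 1)) := by
      ext p
      simp only [mem_preimage, Set.mem_pi, Set.mem_prod, Finset.mem_coe, Finset.mem_preimage]
      constructor
      · intro h
        refine ⟨?_, fun i hi => h (i + 1) hi⟩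
        split_ifs with h0
        · exact h 0 h0
        · trivial
      · rintro ⟨h1, h2⟩ i hi
        cases i with
        | zero => rw [if_pos hi] at h1; exact h1
        | succ i => exact h2 i hi
    rw [e, Measure.prod_prod, Measure.infinitePi_pi _ (fun i _ => ht (i + 1)),
      Finset.prod_preimage' Nat.succ s Nat.succ_injective.injOn (fun i => ν (t i)),
      ← Finset.prod_filter_mul_prod_filter_not s (fun i => i = 0), Finset.filter_eq']
    congr 1
    · split_ifs <;> simp
    · refine Finset.prod_congr ?_ fun _ _ => rfl
      ext i
      simp [Nat.pos_iff_ne_zero]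
  refine ⟨hm, ?_⟩
  conv_lhs => rw [← key, Measure.map_map hm hc]
  exact Measure.map_id

section Walk

variable {D β : Type*} [MeasurableSpace β]

/-- A Markov chain driven by instructions `(u, b)`: from the state `d`, it stays put as long as
`u < s d`, each time rescaling `u`, and otherwise it jumps to `jmp d b` and takes the next
instruction. -/
noncomputable def walk (s : D → ℝ) (jmp : D → β → D) : ℕ → D → ℝ × β × (ℕ → ℝ × β) → D
  | 0, d, _ => d
  | m + 1, d, p =>
    if p.1 < s d then walk s jmp m d (p.1 / s d, p.2)
    else walk s jmp m (jmp d p.2.1) ((p.2.2 0).1, (p.2.2 0).2, fun i => p.2.2 (i + 1))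

/-- The current instruction, separated from the following ones. -/
def headTail (ω : ℕ → ℝ × β) : ℝ × β × (ℕ → ℝ × β) := ((ω 0).1, (ω 0).2, fun i => ω (i + 1))

/-- The law of the instructions. -/
noncomputable def instrLaw (μ : Measure β) : Measure (ℕ → ℝ × β) :=
  Measure.infinitePi fun _ => unif.prod μ

instance (μ : Measure β) [IsProbabilityMeasure μ] : IsProbabilityMeasure (instrLaw μ) := by
  unfold instrLaw; infer_instance

lemma measurePreserving_headTail (μ : Measure β) [IsProbabilityMeasure μ] :
    MeasurePreserving (headTail (β := β)) (instrLaw μ) (unif.prod (μ.prod (instrLaw μ))) := by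
  have h := (measurePreserving_prodAssoc unif μ (instrLaw μ)).comp
    (measurePreserving_head_tail (unif.prod μ))
  exact h

variable [MeasurableSpace D] [Countable D] [MeasurableSingletonClass D]
  {s : D → ℝ} {jmp : D → β → D}

lemma measurable_walk (hj : ∀ d, Measurable (jmp d)) (m : ℕ) (d : D) :
    Measurable (walk s jmp m d) := by
  induction m generalizing d with
  | zero => exact measurable_const
  | succ m ih =>
    refine Measurable.ite (measurableSet_lt measurable_fst measurable_const) ?_ ?_
    · exact (ih d).comp (by fun_prop)
    · have h : Measurable (fun p : D × (ℝ × β × (ℕ → ℝ × β)) => walk s jmp m p.1 p.2) :=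
        measurable_from_prod_countable_right ih
      have hd := hj d
      exact h.comp (show Measurable (fun p : ℝ × β × (ℕ → ℝ × β) =>
        (jmp d p.2.1, ((p.2.2 0).1, (p.2.2 0).2, fun i => p.2.2 (i + 1)))) by fun_prop)

open Classical in
/-- The transition probabilities of `walk`. -/
noncomputable def walkKernel (μ : Measure β) (s : D → ℝ) (jmp : D → β → D) (d x : D) : ℝ≥0∞ :=
  (if x = d then ENNReal.ofReal (s d) else 0) + ENNReal.ofReal (1 - s d) * μ {b | jmp d b = x}

-- Induction on the first step: either `u < s d` and the rescaled instruction is as good as new, or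
-- the chain jumps and the next instruction, independent of the past, becomes current.
open Classical in
lemma walk_law (μ : Measure β) [IsProbabilityMeasure μ] (hs : ∀ d, s d ∈ Icc (0 : ℝ) 1)
    (hj : ∀ d, Measurable (jmp d)) (m : ℕ) (d : D) (w : ℕ → D) :
    (unif.prod (μ.prod (instrLaw μ))) {p | ∀ j ≤ m, walk s jmp j d p = w j} =
      if w 0 = d then ∏ j ∈ Finset.range m, walkKernel μ s jmp (w j) (w (j + 1)) else 0 := by
  have hmeas : ∀ m d (w : ℕ → D), MeasurableSet {p | ∀ j ≤ m, walk s jmp j d p = w j} := by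
    intro m d w
    simp only [ofPred_forall]
    exact MeasurableSet.iInter fun j => MeasurableSet.iInter fun _ =>
      measurable_walk hj j d (measurableSet_singleton _)
  induction m generalizing d w with
  | zero =>
    by_cases h : w 0 = d
    · simp [walk, h]
    · simp [walk, h, Ne.symm h]
  | succ m ih =>
    by_cases h : w 0 = d
    swap
    · rw [if_neg h, ← nonpos_iff_eq_zero, ← measure_empty (μ := unif.prod (μ.prod (instrLaw μ)))]
      refine measure_mono fun p hp => h ?_
      exact (hp 0 (Nat.zero_le _)).symm
    set Ev : D → Set (ℝ × β × (ℕ → ℝ × β)) :=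
      fun x => {p | ∀ j ≤ m, walk s jmp j x p = w (j + 1)} with hEv
    have hEvm : ∀ x, MeasurableSet (Ev x) := fun x => hmeas m x _
    have ih' : ∀ x, (unif.prod (μ.prod (instrLaw μ))) (Ev x) = if w 1 = x then
        ∏ j ∈ Finset.range m, walkKernel μ s jmp (w (j + 1)) (w (j + 1 + 1)) else 0 :=
      fun x => ih x fun j => w (j + 1)
    set A : Set (ℝ × β × (ℕ → ℝ × β)) := {p | p.1 < s d ∧ (p.1 / s d, p.2) ∈ Ev d} with hA
    set C : Set (β × (ℕ → ℝ × β)) := {b | jmp d b = w 1} ×ˢ (headTail ⁻¹' Ev (w 1)) with hC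
    have hCm : MeasurableSet C :=
      ((hj d) (measurableSet_singleton _)).prod
        ((measurePreserving_headTail μ).measurable (hEvm _))
    have hAm : MeasurableSet A := by
      refine (measurableSet_lt measurable_fst measurable_const).inter ?_
      exact (show Measurable (fun p : ℝ × β × (ℕ → ℝ × β) => (p.1 / s d, p.2)) by fun_prop)
        (hEvm d)
    have hset : {p | ∀ j ≤ m + 1, walk s jmp j d p = w j} = A ∪ Ici (s d) ×ˢ C := by
      ext p
      have e : p ∈ {p | ∀ j ≤ m + 1, walk s jmp j d p = w j} ↔
          ∀ j ≤ m, walk s jmp (j + 1) d p = w (j + 1) := by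
        constructor
        · exact fun hp j hj => hp (j + 1) (by omega)
        · intro hp j hj
          rcases j with _ | j
          · exact h.symm
          · exact hp j (by omega)
      rw [e]
      by_cases hu : p.1 < s d
      · simp [hA, hEv, walk, hu]
      · simp only [walk, hA, hC, hEv, mem_union, mem_ofPred_eq, mem_prod, mem_Ici,
          mem_preimage, headTail, hu, false_and, false_or, not_lt.1 hu, true_and]
        constructor
        · intro hp
          have h1 : jmp d p.2.1 = w 1 := hp 0 (Nat.zero_le _)
          exact ⟨h1, fun j hj => h1 ▸ hp j hj⟩
        · rintro ⟨h1, h2⟩ j hj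
          exact h1 ▸ h2 j hj
    have hAmeas : (unif.prod (μ.prod (instrLaw μ))) A =
        ENNReal.ofReal (s d) * (unif.prod (μ.prod (instrLaw μ))) (Ev d) := by
      rw [Measure.prod_apply hAm, Measure.prod_apply (hEvm d),
        ← lintegral_unif_scale (hs d).1 (hs d).2 (measurable_measure_prodMk_left (hEvm d))]
      refine lintegral_congr fun u => ?_
      by_cases hu : u < s d
      · rw [indicator_of_mem (show u ∈ Iio (s d) from hu)]
        congr 1
        ext p
        simp [hA, hu]
      · rw [indicator_of_notMem (show u ∉ Iio (s d) from hu)]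
        convert measure_empty (μ := μ.prod (instrLaw μ))
        ext p
        simp [hA, hu]
    have hdisj : Disjoint A (Ici (s d) ×ˢ C) := by
      rw [Set.disjoint_left]
      rintro p hp ⟨hp2, _⟩
      exact absurd hp.1 (not_lt.2 hp2)
    rw [hset, measure_union hdisj (measurableSet_Ici.prod hCm), hAmeas, Measure.prod_prod,
      unif_Ici (hs d).1 (hs d).2, hC, Measure.prod_prod,
      (measurePreserving_headTail μ).measure_preimage (hEvm _).nullMeasurableSet, ih', ih',
      if_pos rfl, if_pos h, Finset.prod_range_succ', walkKernel, h]
    by_cases h1 : w 1 = d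
    · simp [h1]; ring
    · simp [h1]; ring

end Walk

/-! ### Filling in the odd times -/

lemma exists_measurable_of_weights {D : Type*} [MeasurableSpace D] [Fintype D]
    [MeasurableSingletonClass D] {p : D → ℝ} (hp : ∀ x, 0 ≤ p x) (hp1 : ∑ x, p x = 1) :
    ∃ g : unitInterval → D, Measurable g ∧ ∀ x, volume (g ⁻¹' {x}) = ENNReal.ofReal (p x) := by
  have hne : Nonempty D := by
    by_contra h
    rw [not_nonempty_iff] at h
    simp at hp1
  let P : PMF D := PMF.ofFintype (fun x => ENNReal.ofReal (p x))
    (by rw [← ENNReal.ofReal_sum_of_nonneg fun x _ => hp x, hp1, ENNReal.ofReal_one])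
  obtain ⟨g, hg, h⟩ := Measure.exists_measurable_map_eq P.toMeasure
  refine ⟨g, hg, fun x => ?_⟩
  rw [← Measure.map_apply hg (measurableSet_singleton x), h,
    PMF.toMeasure_apply_singleton _ _ (measurableSet_singleton x)]
  rfl

section Bridge

variable {Ω D : Type*} [MeasurableSpace Ω] [MeasurableSpace D] [Fintype D]
  [MeasurableSingletonClass D] {μ : Measure Ω} {P : D → D → ℝ} {a : D}

/-- Samples the middle state given the two outer ones. Multiplying out the conditional probability
covers pairs of two step weight zero, where any map will do. -/
lemma exists_bridge_map (hP : ∀ x y, 0 ≤ P x y) (x z : D) :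
    ∃ g : unitInterval → D, Measurable g ∧
      ∀ y, (∑ y, P x y * P y z) * (volume.real (g ⁻¹' {y})) = P x y * P y z := by
  have h0 : ∀ y, 0 ≤ P x y * P y z := fun y => mul_nonneg (hP _ _) (hP _ _)
  by_cases h : ∑ y, P x y * P y z = 0
  · refine ⟨fun _ => x, measurable_const, fun y => ?_⟩
    rw [h, zero_mul, (Finset.sum_eq_zero_iff_of_nonneg fun y _ => h0 y).1 h y (Finset.mem_univ y)]
  · obtain ⟨g, hg, hgv⟩ := exists_measurable_of_weights
      (p := fun y => P x y * P y z / ∑ y, P x y * P y z)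
      (fun y => div_nonneg (h0 y) (Finset.sum_nonneg fun y _ => h0 y))
      (by rw [← Finset.sum_div, div_self h])
    refine ⟨g, hg, fun y => ?_⟩
    rw [Measure.real, hgv, ENNReal.toReal_ofReal
      (div_nonneg (h0 y) (Finset.sum_nonneg fun y _ => h0 y)), mul_div_cancel₀ _ h]

/-- It suffices to know the finite dimensional laws of a Markov chain at even times. -/
lemma isDiscreteMarkovChain_of_even [IsProbabilityMeasure μ] (hP1 : ∀ x, ∑ y, P x y = 1)
    {X : ℕ → Ω → D} (hX : ∀ i, Measurable (X i))
    (h : ∀ (m : ℕ) (x : ℕ → D), x 0 = a → μ.real {ω | ∀ i ≤ 2 * m, X i ω = x i} =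
      ∏ i ∈ Finset.range (2 * m), P (x i) (x (i + 1)))
    (h0 : ∀ ω, X 0 ω = a) :
    IsDiscreteMarkovChain μ P a X := by
  classical
  refine ⟨hX, fun k x => ?_⟩
  split_ifs with hx
  swap
  · have : {ω | ∀ i ≤ k, X i ω = x i} = ∅ := by
      ext ω
      simp only [mem_ofPred_eq, mem_empty_iff_false, iff_false]
      intro hω
      exact hx ((hω 0 (Nat.zero_le _)).symm.trans (h0 ω))
    rw [this, measureReal_empty]
  rcases Nat.even_or_odd' k with ⟨m, rfl | rfl⟩
  · exact h m x hx
  · have hu : {ω | ∀ i ≤ 2 * m + 1, X i ω = x i} =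
        ⋃ y, {ω | ∀ i ≤ 2 * (m + 1), X i ω = Function.update x (2 * (m + 1)) y i} := by
      ext ω
      simp only [mem_ofPred_eq, mem_iUnion]
      constructor
      · intro hω
        refine ⟨X (2 * (m + 1)) ω, fun i hi => ?_⟩
        by_cases hi' : i = 2 * (m + 1)
        · rw [hi', Function.update_self]
        · rw [Function.update_of_ne hi', hω i (by omega)]
      · rintro ⟨y, hy⟩ i hi
        rw [hy i (by omega), Function.update_of_ne (by omega)]
    have hterm : ∀ y, μ.real {ω | ∀ i ≤ 2 * (m + 1), X i ω =
        Function.update x (2 * (m + 1)) y i} =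
          (∏ i ∈ Finset.range (2 * m + 1), P (x i) (x (i + 1))) * P (x (2 * m + 1)) y := by
      intro y
      rw [h (m + 1) _ (by rw [Function.update_of_ne (by omega), hx]),
        show 2 * (m + 1) = 2 * m + 1 + 1 by ring, Finset.prod_range_succ, Function.update_self,
        Function.update_of_ne (by omega)]
      congr 1
      refine Finset.prod_congr rfl fun i hi => ?_
      have hi := Finset.mem_range.1 hi
      rw [Function.update_of_ne (by omega), Function.update_of_ne (by omega)]
    rw [hu, measureReal_iUnion_fintype]
    · simp only [hterm]
      rw [← Finset.mul_sum, hP1, mul_one]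
    · intro y z hyz
      refine Set.disjoint_left.2 fun ω hy hz => hyz ?_
      have e1 := hy _ le_rfl
      have e2 := hz _ le_rfl
      rw [Function.update_self] at e1 e2
      rw [← e1, e2]
    · intro y
      simp only [ofPred_forall]
      exact MeasurableSet.iInter fun j => MeasurableSet.iInter fun _ =>
        hX j (measurableSet_singleton _)

/-- A Markov chain with transition matrix `P²` extends to a Markov chain with transition matrix
`P`, of which it consists of the even times. -/
lemma exists_bridge [IsProbabilityMeasure μ]
    (hP : ∀ x y, 0 ≤ P x y) (hP1 : ∀ x, ∑ y, P x y = 1) {W : ℕ → Ω → D}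
    (hW : IsDiscreteMarkovChain μ (fun x z => ∑ y, P x y * P y z) a W) (hW0 : ∀ ω, W 0 ω = a) :
    ∃ X : ℕ → Ω × (ℕ → unitInterval) → D,
      IsDiscreteMarkovChain (μ.prod (Measure.infinitePi fun _ => volume)) P a X ∧
      ∀ k p, X (2 * k) p = W k p.1 := by
  choose g hg hgv using fun x z => exists_bridge_map hP x z
  let X : ℕ → Ω × (ℕ → unitInterval) → D := fun i p =>
    if Even i then W (i / 2) p.1 else g (W (i / 2) p.1) (W (i / 2 + 1) p.1) (p.2 (i / 2))
  have hX0 : ∀ k p, X (2 * k) p = W k p.1 := fun k p => by simp [X]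
  have hX1 : ∀ k p, X (2 * k + 1) p = g (W k p.1) (W (k + 1) p.1) (p.2 k) := fun k p => by
    simp only [X, if_neg (Nat.not_even_bit1 k)]
    rw [show (2 * k + 1) / 2 = k by omega]
  have hXm : ∀ i, Measurable (X i) := by
    intro i
    rcases Nat.even_or_odd' i with ⟨k, rfl | rfl⟩
    · rw [funext (hX0 k)]
      exact (hW.measurable k).comp measurable_fst
    · rw [funext (hX1 k)]
      have h : Measurable fun p : D × D × unitInterval => g p.1 p.2.1 p.2.2 :=
        measurable_from_prod_countable_right fun x =>
          measurable_from_prod_countable_right fun z => hg x z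
      exact h.comp (((hW.measurable k).comp measurable_fst).prodMk
        (((hW.measurable (k + 1)).comp measurable_fst).prodMk
          ((measurable_pi_apply k).comp measurable_snd)))
  refine ⟨X, isDiscreteMarkovChain_of_even hP1 hXm ?_ fun p => (hX0 0 p).trans (hW0 _), hX0⟩
  intro m x hx
  have hset : {p | ∀ i ≤ 2 * m, X i p = x i} = {ω | ∀ j ≤ m, W j ω = x (2 * j)} ×ˢ
      Set.pi (Finset.range m) fun j => g (x (2 * j)) (x (2 * (j + 1))) ⁻¹' {x (2 * j + 1)} := by
    ext p
    simp only [mem_ofPred_eq, mem_prod, Set.mem_pi, Finset.coe_range, mem_Iio, mem_preimage,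
      mem_singleton_iff]
    constructor
    · intro hp
      have hp0 : ∀ j ≤ m, W j p.1 = x (2 * j) := fun j hj => by
        rw [← hX0]; exact hp _ (by omega)
      refine ⟨hp0, fun j hj => ?_⟩
      rw [← hp0 j hj.le, ← hp0 (j + 1) hj, ← hX1]
      exact hp _ (by omega)
    · rintro ⟨hp0, hp1⟩ i hi
      rcases Nat.even_or_odd' i with ⟨k, rfl | rfl⟩
      · rw [hX0]
        exact hp0 k (by omega)
      · rw [hX1, hp0 k (by omega), hp0 (k + 1) (by omega)]
        exact hp1 k (by omega)
  have hWl := hW.law m fun j => x (2 * j)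
  rw [hset, measureReal_prod_prod, hWl, if_pos hx, Measure.real,
    Measure.infinitePi_pi _ fun j _ => hg _ _ (measurableSet_singleton _), ENNReal.toReal_prod,
    ← Finset.prod_mul_distrib]
  simp only [← Measure.real_def, hgv]
  clear hset hWl
  induction m with
  | zero => simp
  | succ m ih =>
    rw [Finset.prod_range_succ, ih, show 2 * (m + 1) = 2 * m + 1 + 1 by ring,
      Finset.prod_range_succ, Finset.prod_range_succ, mul_assoc]

end Bridge

lemma walk_isDiscreteMarkovChain {D β : Type*} [MeasurableSpace β] [MeasurableSpace D]
    [Countable D] [MeasurableSingletonClass D] {s : D → ℝ} {jmp : D → β → D} (μ : Measure β)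
    [IsProbabilityMeasure μ] (hs : ∀ d, s d ∈ Icc (0 : ℝ) 1) (hj : ∀ d, Measurable (jmp d))
    {K : D → D → ℝ} (hK0 : ∀ d x, 0 ≤ K d x)
    (hK : ∀ d x, walkKernel μ s jmp d x = ENNReal.ofReal (K d x)) (a : D) :
    IsDiscreteMarkovChain (instrLaw μ) K a fun m ω => walk s jmp m a (headTail ω) := by
  classical
  have hm := measurePreserving_headTail μ
  refine ⟨fun m => (measurable_walk hj m a).comp hm.measurable, fun k x => ?_⟩
  have hE : MeasurableSet {p | ∀ j ≤ k, walk s jmp j a p = x j} := by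
    simp only [ofPred_forall]
    exact MeasurableSet.iInter fun j => MeasurableSet.iInter fun _ =>
      measurable_walk hj j a (measurableSet_singleton _)
  have h := hm.measure_preimage hE.nullMeasurableSet
  rw [walk_law μ hs hj] at h
  rw [Measure.real]
  refine (congrArg ENNReal.toReal h).trans ?_
  split_ifs
  · simp only [hK]
    rw [ENNReal.toReal_prod]
    simp only [ENNReal.toReal_ofReal (hK0 _ _)]
  · rfl

/-! ### Jump processes built from instructions -/

lemma jumpTime_eq {S : Type*} {f : ℝ≥0 → S} {t : ℕ → ℝ≥0} {N : ℕ} (h0 : t 0 = 0)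
    (hlt : ∀ i < N, t i < t (i + 1))
    (hc : ∀ i < N, ∀ s, t i ≤ s → s < t (i + 1) → f s = f (t i))
    (hne : ∀ i < N, f (t (i + 1)) ≠ f (t i)) : ∀ i ≤ N, jumpTime f i = t i := by
  intro i
  induction i with
  | zero => intro _; simp [jumpTime, h0]
  | succ i ih =>
    intro hi
    have hi' : i < N := hi
    rw [jumpTime, ih hi'.le]
    simp only [ENNReal.toNNReal_coe, ENNReal.coe_lt_coe]
    refine le_antisymm (sInf_le ⟨t (i + 1), ⟨hlt i hi', hne i hi'⟩, rfl⟩) (le_sInf ?_)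
    rintro _ ⟨s, ⟨hs1, hs2⟩, rfl⟩
    rw [ENNReal.coe_le_coe]
    by_contra h
    exact hs2 (hc i hi' s hs1.le (not_le.1 h))

section JumpProcess

variable {S β : Type*}

/-- The jump chain driven by a sequence of instructions. -/
def jchain (zst : S → β → S) (a : S) (ω : ℕ → ℝ × β) : ℕ → S
  | 0 => a
  | i + 1 => zst (jchain zst a ω i) (ω i).2

/-- The holding times driven by a sequence of instructions. -/
noncomputable def jhold (lam : S → ℝ) (zst : S → β → S) (a : S) (ω : ℕ → ℝ × β) (i : ℕ) : ℝ :=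
  -Real.log (ω i).1 / lam (jchain zst a ω i)

/-- The jump times driven by a sequence of instructions. -/
noncomputable def jtime (lam : S → ℝ) (zst : S → β → S) (a : S) (ω : ℕ → ℝ × β) (i : ℕ) : ℝ :=
  ∑ j ∈ Finset.range i, jhold lam zst a ω j

/-- The instructions which lead to a path with finitely many jumps on bounded intervals. -/
def goodInstr (lam : S → ℝ) (zst : S → β → S) (a : S) : Set (ℕ → ℝ × β) :=
  {ω | (∀ i, (ω i).1 ∈ Ioo (0 : ℝ) 1) ∧ ∀ k : ℕ, ∃ i, (k : ℝ) ≤ jtime lam zst a ω i}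

open Classical in
/-- The path of the jump process driven by a sequence of instructions. -/
noncomputable def jpath (lam : S → ℝ) (zst : S → β → S) (a : S) (t : ℝ≥0) (ω : ℕ → ℝ × β) : S :=
  if h : ω ∈ goodInstr lam zst a ∧
      ∃ i, jtime lam zst a ω i ≤ t ∧ (t : ℝ) < jtime lam zst a ω (i + 1) then
    jchain zst a ω h.2.choose
  else a

variable {lam : S → ℝ} {zst : S → β → S} {a : S}

lemma jchain_succ' (ω : ℕ → ℝ × β) (i : ℕ) :
    jchain zst a ω (i + 1) = jchain zst (zst a (ω 0).2) (fun i => ω (i + 1)) i := by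
  induction i with
  | zero => rfl
  | succ i ih => rw [jchain, ih]; rfl

lemma jtime_succ (ω : ℕ → ℝ × β) (i : ℕ) :
    jtime lam zst a ω (i + 1) = jtime lam zst a ω i + jhold lam zst a ω i :=
  Finset.sum_range_succ _ _

/-- Decomposition at the first jump, used to run inductions that restart from the new state. -/
lemma jtime_succ' (ω : ℕ → ℝ × β) (i : ℕ) :
    jtime lam zst a ω (i + 1) =
      -Real.log (ω 0).1 / lam a + jtime lam zst (zst a (ω 0).2) (fun i => ω (i + 1)) i := by
  rw [jtime, Finset.sum_range_succ', add_comm]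
  congr 1
  refine Finset.sum_congr rfl fun j _ => ?_
  rw [jhold, jchain_succ']
  rfl

section Path

variable {ω : ℕ → ℝ × β}

lemma jhold_pos (hl : ∀ x, 0 < lam x) (hω : ω ∈ goodInstr lam zst a) (i : ℕ) :
    0 < jhold lam zst a ω i :=
  div_pos (neg_pos.2 (Real.log_neg (hω.1 i).1 (hω.1 i).2)) (hl _)

lemma strictMono_jtime (hl : ∀ x, 0 < lam x) (hω : ω ∈ goodInstr lam zst a) :
    StrictMono (jtime lam zst a ω) :=
  strictMono_nat_of_lt_succ fun i => by rw [jtime_succ]; linarith [jhold_pos hl hω i]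

lemma jpath_eq (hl : ∀ x, 0 < lam x) (hω : ω ∈ goodInstr lam zst a) {t : ℝ≥0} {i : ℕ}
    (h1 : jtime lam zst a ω i ≤ t)
    (h2 : (t : ℝ) < jtime lam zst a ω (i + 1)) : jpath lam zst a t ω = jchain zst a ω i := by
  have h : ω ∈ goodInstr lam zst a ∧
      ∃ i, jtime lam zst a ω i ≤ t ∧ (t : ℝ) < jtime lam zst a ω (i + 1) := ⟨hω, i, h1, h2⟩
  rw [jpath, dif_pos h]
  congr 1
  obtain ⟨h3, h4⟩ := h.2.choose_spec
  have hm := strictMono_jtime hl hω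
  have a1 := hm.lt_iff_lt.1 (h1.trans_lt h4)
  have a2 := hm.lt_iff_lt.1 (h3.trans_lt h2)
  omega

lemma exists_jtime_le_lt (hω : ω ∈ goodInstr lam zst a) (t : ℝ≥0) :
    ∃ i, jtime lam zst a ω i ≤ t ∧ (t : ℝ) < jtime lam zst a ω (i + 1) := by
  classical
  have hex : ∃ j, (t : ℝ) < jtime lam zst a ω j := by
    obtain ⟨k, hk⟩ := exists_nat_gt (t : ℝ)
    obtain ⟨i, hi⟩ := hω.2 k
    exact ⟨i, hk.trans_le hi⟩
  have hne : Nat.find hex ≠ 0 := by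
    intro h0
    have := Nat.find_spec hex
    rw [h0] at this
    simp [jtime] at this
  obtain ⟨i, hi⟩ := Nat.exists_eq_succ_of_ne_zero hne
  refine ⟨i, not_lt.1 (Nat.find_min hex (by omega)), ?_⟩
  have := Nat.find_spec hex
  rwa [hi] at this

lemma jtime_nonneg (hl : ∀ x, 0 < lam x) (hω : ω ∈ goodInstr lam zst a) (i : ℕ) :
    0 ≤ jtime lam zst a ω i :=
  Finset.sum_nonneg fun j _ => (jhold_pos hl hω j).le

lemma jpath_jtime (hl : ∀ x, 0 < lam x) (hω : ω ∈ goodInstr lam zst a) (i : ℕ) :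
    jpath lam zst a (jtime lam zst a ω i).toNNReal ω = jchain zst a ω i := by
  have h := Real.coe_toNNReal _ (jtime_nonneg hl hω i)
  refine jpath_eq hl hω h.ge ?_
  rw [h]
  exact strictMono_jtime hl hω (Nat.lt_succ_self i)

lemma jumpTime_jpath (hl : ∀ x, 0 < lam x) (hz : ∀ x b, zst x b ≠ x)
    (hω : ω ∈ goodInstr lam zst a) (i : ℕ) :
    jumpTime (fun t => jpath lam zst a t ω) i = ((jtime lam zst a ω i).toNNReal : ℝ≥0∞) := by
  have hm := strictMono_jtime hl hω
  have hn := jtime_nonneg hl hω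
  refine jumpTime_eq (t := fun i => (jtime lam zst a ω i).toNNReal) (N := i) (by simp [jtime]) ?_ ?_
    ?_ i le_rfl
  · intro j _
    exact (Real.toNNReal_lt_toNNReal_iff_of_nonneg (hn j)).2 (hm (Nat.lt_succ_self j))
  · intro j _ s h1 h2
    rw [jpath_jtime hl hω]
    refine jpath_eq hl hω ?_ ?_
    · exact (Real.toNNReal_le_iff_le_coe).1 h1
    · exact Real.lt_toNNReal_iff_coe_lt.1 h2
  · intro j _
    rw [jpath_jtime hl hω, jpath_jtime hl hω]
    exact hz _ _

lemma embedded_jpath (hl : ∀ x, 0 < lam x) (hz : ∀ x b, zst x b ≠ x)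
    (hω : ω ∈ goodInstr lam zst a) (i : ℕ) :
    embedded (fun t => jpath lam zst a t ω) i = jchain zst a ω i := by
  rw [embedded, jumpTime_jpath hl hz hω, ENNReal.toNNReal_coe, jpath_jtime hl hω]

end Path

variable [MeasurableSpace β] [MeasurableSpace S] [MeasurableSingletonClass S]

lemma measurable_jchain [Countable S] (hz : ∀ x, Measurable (zst x)) (a : S) (i : ℕ) :
    Measurable fun ω : ℕ → ℝ × β => jchain zst a ω i := by
  induction i with
  | zero => exact measurable_const
  | succ i ih =>
    have h : Measurable fun p : S × β => zst p.1 p.2 := measurable_from_prod_countable_right hz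
    exact h.comp (ih.prodMk (measurable_snd.comp (measurable_pi_apply i)))

lemma measurable_jhold [Countable S] (hz : ∀ x, Measurable (zst x)) (a : S) (i : ℕ) :
    Measurable fun ω : ℕ → ℝ × β => jhold lam zst a ω i := by
  refine Measurable.div (Real.measurable_log.comp
    (measurable_fst.comp (measurable_pi_apply i))).neg ?_
  exact (measurable_of_countable lam).comp (measurable_jchain hz a i)

lemma measurable_jtime [Countable S] (hz : ∀ x, Measurable (zst x)) (a : S) (i : ℕ) :
    Measurable fun ω : ℕ → ℝ × β => jtime lam zst a ω i :=
  Finset.measurable_sum _ fun j _ => measurable_jhold hz a j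

lemma measurableSet_goodInstr [Countable S] (hz : ∀ x, Measurable (zst x)) (a : S) :
    MeasurableSet (goodInstr lam zst a) := by
  refine MeasurableSet.inter (s₁ := {ω | ∀ i, (ω i).1 ∈ Ioo (0 : ℝ) 1})
    (s₂ := {ω | ∀ k : ℕ, ∃ i, (k : ℝ) ≤ jtime lam zst a ω i}) ?_ ?_
  · rw [ofPred_forall]
    exact MeasurableSet.iInter fun i =>
      (measurable_fst.comp (measurable_pi_apply i)) measurableSet_Ioo
  · rw [ofPred_forall]
    refine MeasurableSet.iInter fun k => ?_
    rw [ofPred_exists]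
    exact MeasurableSet.iUnion fun i => measurableSet_le measurable_const (measurable_jtime hz a i)

lemma measurable_jpath [Countable S] (hl : ∀ x, 0 < lam x) (hz : ∀ x, Measurable (zst x))
    (a : S) (t : ℝ≥0) :
    Measurable (jpath (β := β) lam zst a t) := by
  refine measurable_to_countable' fun x => ?_
  have : jpath lam zst a t ⁻¹' {x} =
      (goodInstr lam zst a ∩ ⋃ i, ({ω | jtime lam zst a ω i ≤ t} ∩
        {ω | (t : ℝ) < jtime lam zst a ω (i + 1)} ∩ {ω | jchain zst a ω i = x})) ∪
      ((goodInstr lam zst a)ᶜ ∩ {_ω | a = x}) := by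
    ext ω
    by_cases hω : ω ∈ goodInstr lam zst a
    · simp only [mem_preimage, mem_singleton_iff, mem_union, mem_inter_iff, hω, true_and,
        mem_iUnion, mem_ofPred_eq, mem_compl_iff, not_true_eq_false, false_and, or_false]
      constructor
      · intro h
        obtain ⟨i, h1, h2⟩ := exists_jtime_le_lt hω t
        exact ⟨i, ⟨h1, h2⟩, by rw [← h, jpath_eq hl hω h1 h2]⟩
      · rintro ⟨i, ⟨h1, h2⟩, h3⟩
        rw [jpath_eq hl hω h1 h2, h3]
    · simp [jpath, hω]
  rw [this]
  have hg := measurableSet_goodInstr (lam := lam) hz a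
  refine (hg.inter (MeasurableSet.iUnion fun i => ?_)).union
    (hg.compl.inter (MeasurableSet.const _))
  exact ((measurableSet_le (measurable_jtime hz a i) measurable_const).inter
    (measurableSet_lt measurable_const (measurable_jtime hz a (i + 1)))).inter
      (measurable_jchain hz a i (measurableSet_singleton x))

/-- Inverse transform sampling: `-log u / l` is exponential with parameter `l`. -/
lemma unif_lt_neg_log_div {l : ℝ} (hl : 0 < l) (h : ℝ≥0) :
    unif {u | (h : ℝ) < -Real.log u / l} = ENNReal.ofReal (Real.exp (-l * h)) := by
  rw [← unif_Iio (x := Real.exp (-l * h))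
    (Real.exp_le_one_iff.2 (by have := mul_nonneg hl.le h.2; simp at *; linarith))]
  refine measure_congr ?_
  filter_upwards [ae_unif] with u hu
  refine propext ?_
  change (h : ℝ) < -Real.log u / l ↔ u < Real.exp (-l * h)
  rw [lt_div_iff₀ hl, ← Real.log_lt_iff_lt_exp hu.1]
  constructor <;> intro h <;> linarith

variable (μ : Measure β) [IsProbabilityMeasure μ]

-- Once the states are prescribed, each condition concerns a single instruction, so the event is a
-- box and its measure a product.
open Classical in
lemma jchain_law (hl : ∀ x, 0 < lam x) (hz : ∀ x, Measurable (zst x)) (a : S) (k : ℕ) (x : ℕ → S)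
    (h : ℕ → ℝ≥0) :
    instrLaw μ {ω | (∀ i ≤ k, jchain zst a ω i = x i) ∧ ∀ i < k, (h i : ℝ) < jhold lam zst a ω i} =
      if x 0 = a then ∏ i ∈ Finset.range k,
        ENNReal.ofReal (Real.exp (-lam (x i) * h i)) * μ {b | zst (x i) b = x (i + 1)} else 0 := by
  split_ifs with hx
  · have hset : {ω | (∀ i ≤ k, jchain zst a ω i = x i) ∧
        ∀ i < k, (h i : ℝ) < jhold lam zst a ω i} = Set.pi (Finset.range k) fun i =>
          {u | (h i : ℝ) < -Real.log u / lam (x i)} ×ˢ {b | zst (x i) b = x (i + 1)} := by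
      ext ω
      simp only [mem_ofPred_eq, Set.mem_pi, Finset.coe_range, mem_Iio, mem_prod, jhold]
      constructor
      · rintro ⟨h1, h2⟩ i hi
        rw [← h1 i hi.le]
        exact ⟨h2 i hi, h1 (i + 1) hi⟩
      · intro hω
        have hc : ∀ i ≤ k, jchain zst a ω i = x i := by
          intro i
          induction i with
          | zero => exact fun _ => hx.symm
          | succ i ih =>
            intro hi
            rw [jchain, ih (by omega)]
            exact (hω i hi).2
        refine ⟨hc, fun i hi => ?_⟩
        rw [hc i hi.le]
        exact (hω i hi).1
    rw [hset, instrLaw, Measure.infinitePi_pi]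
    · exact Finset.prod_congr rfl fun i _ => by
        rw [Measure.prod_prod, unif_lt_neg_log_div (hl _)]
    · intro i _
      exact (measurableSet_lt measurable_const (Real.measurable_log.neg.div_const _)).prod
        (hz _ (measurableSet_singleton _))
  · convert measure_empty (μ := instrLaw μ)
    ext ω
    simp only [mem_ofPred_eq, mem_empty_iff_false, iff_false]
    exact fun hω => hx (hω.1 0 (Nat.zero_le _)).symm

lemma ae_instrLaw_mem_Ioo : ∀ᵐ ω ∂(instrLaw μ), ∀ i, (ω i).1 ∈ Ioo (0 : ℝ) 1 := by
  rw [ae_all_iff]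
  intro i
  have h1 : MeasurePreserving (fun ω : ℕ → ℝ × β => (ω i).1) (instrLaw μ) unif :=
    measurePreserving_fst.comp (measurePreserving_eval_infinitePi (fun _ => unif.prod μ) i)
  exact h1.quasiMeasurePreserving.ae ae_unif

lemma jpath_isMarkovJumpProcess [Countable S] (hl : ∀ x, 0 < lam x) (hz : ∀ x, Measurable (zst x))
    (hzne : ∀ x b, zst x b ≠ x) {Q : S → S → ℝ} (hQ : ∀ x, Q x x = -lam x)
    (hQz : ∀ x y, x ≠ y → μ.real {b | zst x b = y} = Q x y / lam x) (a : S)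
    (hgood : ∀ᵐ ω ∂(instrLaw μ), ω ∈ goodInstr lam zst a) {Ω : Type*} [MeasurableSpace Ω]
    {ν : Measure Ω} {I : Ω → ℕ → ℝ × β} (hI : MeasurePreserving I ν (instrLaw μ)) :
    IsMarkovJumpProcess ν Q a fun t p => jpath lam zst a t (I p) where
  measurable t := (measurable_jpath hl hz a t).comp hI.measurable
  right_continuous := by
    filter_upwards [hI.quasiMeasurePreserving.ae hgood] with p hω t
    obtain ⟨i, h1, h2⟩ := exists_jtime_le_lt hω t
    have h2' : t < (jtime lam zst a (I p) (i + 1)).toNNReal := Real.lt_toNNReal_iff_coe_lt.2 h2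
    filter_upwards [Ioo_mem_nhdsGT h2'] with s hs
    rw [jpath_eq hl hω h1 h2, jpath_eq hl hω (h1.trans (by exact_mod_cast hs.1.le))
      (Real.lt_toNNReal_iff_coe_lt.1 hs.2)]
  non_explosive := by
    filter_upwards [hI.quasiMeasurePreserving.ae hgood] with p hω
    rw [funext (jumpTime_jpath hl hzne hω), ENNReal.tendsto_coe_nhds_top]
    refine tendsto_atTop_atTop.2 fun b => ?_
    obtain ⟨k, hk⟩ := exists_nat_ge (b : ℝ)
    obtain ⟨i, hi⟩ := hω.2 k
    refine ⟨i, fun j hj => ?_⟩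
    rw [Real.le_toNNReal_iff_coe_le (jtime_nonneg hl hω j)]
    exact hk.trans (hi.trans ((strictMono_jtime hl hω).monotone hj))
  law := by
    classical
    intro k x h
    have hset : {p | (∀ i ≤ k, embedded (fun t => jpath lam zst a t (I p)) i = x i) ∧
        ∀ i < k, jumpTime (fun t => jpath lam zst a t (I p)) i + (h i : ℝ≥0∞) <
          jumpTime (fun t => jpath lam zst a t (I p)) (i + 1)} =ᵐ[ν]
        I ⁻¹' {ω | (∀ i ≤ k, jchain zst a ω i = x i) ∧
          ∀ i < k, (h i : ℝ) < jhold lam zst a ω i} := by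
      filter_upwards [hI.quasiMeasurePreserving.ae hgood] with p hω
      refine propext ?_
      change ((∀ i ≤ k, embedded (fun t => jpath lam zst a t (I p)) i = x i) ∧
        ∀ i < k, jumpTime (fun t => jpath lam zst a t (I p)) i + (h i : ℝ≥0∞) <
          jumpTime (fun t => jpath lam zst a t (I p)) (i + 1)) ↔ _ ∧ _
      simp only [embedded_jpath hl hzne hω, jumpTime_jpath hl hzne hω]
      refine and_congr Iff.rfl (forall_congr' fun i => imp_congr Iff.rfl ?_)
      rw [← ENNReal.coe_add, ENNReal.coe_lt_coe, Real.lt_toNNReal_iff_coe_lt, NNReal.coe_add,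
        Real.coe_toNNReal _ (jtime_nonneg hl hω i), jtime_succ]
      simp
    have hm : MeasurableSet {ω : ℕ → ℝ × β | (∀ i ≤ k, jchain zst a ω i = x i) ∧
        ∀ i < k, (h i : ℝ) < jhold lam zst a ω i} := by
      refine MeasurableSet.inter (s₁ := {ω : ℕ → ℝ × β | ∀ i ≤ k, jchain zst a ω i = x i})
        (s₂ := {ω | ∀ i < k, (h i : ℝ) < jhold lam zst a ω i}) ?_ ?_
      · simp only [ofPred_forall]
        exact MeasurableSet.iInter fun i => MeasurableSet.iInter fun _ =>
          measurable_jchain hz a i (measurableSet_singleton _)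
      · simp only [ofPred_forall]
        exact MeasurableSet.iInter fun i => MeasurableSet.iInter fun _ =>
          measurableSet_lt measurable_const (measurable_jhold hz a i)
    rw [measureReal_congr hset, Measure.real, hI.measure_preimage hm.nullMeasurableSet,
      jchain_law μ hl hz]
    split_ifs
    · rw [ENNReal.toReal_prod]
      refine Finset.prod_congr rfl fun i _ => ?_
      rw [ENNReal.toReal_mul, ENNReal.toReal_ofReal (Real.exp_pos _).le, hQ, mul_comm, neg_neg]
      congr 1
      split_ifs with hxy
      · rw [← hxy, show {b | zst (x i) b = x i} = ∅ by ext b; simpa using hzne _ b]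
        simp
      · exact hQz _ _ hxy
    · rfl

end JumpProcess

/-! ### Tails of the jump times and union bound for failures -/

lemma lintegral_unif_exp_log_div {l : ℝ} (hl : 0 < l) :
    ∫⁻ u, ENNReal.ofReal (Real.exp (Real.log u / l)) ∂unif = ENNReal.ofReal (l / (l + 1)) := by
  have h1 : -1 < 1 / l := by have := one_div_pos.2 hl; linarith
  have hint : IntegrableOn (fun u : ℝ => u ^ (1 / l)) (Ioo 0 1) := by
    have := intervalIntegral.intervalIntegrable_rpow' (a := 0) (b := 1) h1
    rw [intervalIntegrable_iff_integrableOn_Ioo_of_le zero_le_one] at this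
    exact this
  have e : ∫⁻ u, ENNReal.ofReal (Real.exp (Real.log u / l)) ∂unif =
      ∫⁻ u, ENNReal.ofReal (u ^ (1 / l)) ∂unif := by
    refine lintegral_congr_ae ?_
    filter_upwards [ae_unif] with u hu
    rw [Real.rpow_def_of_pos hu.1, mul_one_div]
  rw [e, unif, ← ofReal_integral_eq_lintegral_ofReal hint
    ((ae_restrict_mem measurableSet_Ioo).mono fun u hu => Real.rpow_nonneg hu.1.le _),
    ← integral_Ioc_eq_integral_Ioo, ← intervalIntegral.integral_of_le zero_le_one,
    integral_rpow (Or.inl h1)]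
  congr 1
  have : 1 / l + 1 ≠ 0 := by linarith
  rw [Real.one_rpow, Real.zero_rpow this]
  field_simp
  ring

section Tail

variable {S β : Type*} [MeasurableSpace β] [MeasurableSpace S] [Countable S]
  [MeasurableSingletonClass S] {lam : S → ℝ} {zst : S → β → S} {μ : Measure β}
  [IsProbabilityMeasure μ]

lemma lintegral_headTail_mul {f : ℝ → ℝ≥0∞} (hf : Measurable f) {g : β × (ℕ → ℝ × β) → ℝ≥0∞}
    (hg : Measurable g) :
    ∫⁻ ω, f (ω 0).1 * g (headTail ω).2 ∂(instrLaw μ) =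
      (∫⁻ u, f u ∂unif) * ∫⁻ b, ∫⁻ ω, g (b, ω) ∂(instrLaw μ) ∂μ := by
  have hm : Measurable fun p : ℝ × β × (ℕ → ℝ × β) => f p.1 * g p.2 :=
    (hf.comp measurable_fst).mul (hg.comp measurable_snd)
  rw [← lintegral_prod _ hg.aemeasurable, ← lintegral_prod_mul hf.aemeasurable hg.aemeasurable]
  exact (measurePreserving_headTail μ).lintegral_comp hm

/-- The factor `lam/(lam+1)` is the Laplace transform at 1 of the holding time, so `hh` says that
one jump contracts `exp(-time) · h` in mean by `ρ`; conditioning on the first jump iterates this. -/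
lemma lintegral_exp_neg_jtime_le (hl : ∀ x, 0 < lam x) (hz : ∀ x, Measurable (zst x))
    {h : S → ℝ≥0∞} {ρ : ℝ≥0∞}
    (hh : ∀ x, ENNReal.ofReal (lam x / (lam x + 1)) * ∫⁻ b, h (zst x b) ∂μ ≤ ρ * h x)
    (N : ℕ) (x : S) :
    ∫⁻ ω, ENNReal.ofReal (Real.exp (-jtime lam zst x ω N)) * h (jchain zst x ω N) ∂(instrLaw μ) ≤
      ρ ^ N * h x := by
  have hhm : Measurable h := measurable_of_countable h
  have hFm : ∀ N x, Measurable fun ω : ℕ → ℝ × β =>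
      ENNReal.ofReal (Real.exp (-jtime lam zst x ω N)) * h (jchain zst x ω N) := fun N x =>
    (ENNReal.measurable_ofReal.comp (Real.measurable_exp.comp (measurable_jtime hz x N).neg)).mul
      (hhm.comp (measurable_jchain hz x N))
  induction N generalizing x with
  | zero => simp [jtime, jchain]
  | succ N ih =>
    set F : S × (ℕ → ℝ × β) → ℝ≥0∞ := fun p =>
      ENNReal.ofReal (Real.exp (-jtime lam zst p.1 p.2 N)) * h (jchain zst p.1 p.2 N) with hF
    have hFm' : Measurable F := measurable_from_prod_countable_right fun x => hFm N x
    have hgm : Measurable fun p : β × (ℕ → ℝ × β) => F (zst x p.1, p.2) :=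
      hFm'.comp (((hz x).comp measurable_fst).prodMk measurable_snd)
    have hem : Measurable fun u : ℝ => ENNReal.ofReal (Real.exp (Real.log u / lam x)) :=
      ENNReal.measurable_ofReal.comp (Real.measurable_exp.comp (Real.measurable_log.div_const _))
    have e : ∀ ω : ℕ → ℝ × β,
        ENNReal.ofReal (Real.exp (-jtime lam zst x ω (N + 1))) * h (jchain zst x ω (N + 1)) =
          ENNReal.ofReal (Real.exp (Real.log (ω 0).1 / lam x)) *
            F (zst x (headTail ω).2.1, (headTail ω).2.2) := by
      intro ω
      simp only [hF, headTail]
      rw [jtime_succ', jchain_succ', ← mul_assoc, ← ENNReal.ofReal_mul (Real.exp_pos _).le,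
        ← Real.exp_add]
      congr 3
      ring
    have hprod := lintegral_headTail_mul (μ := μ) hem hgm
    rw [lintegral_congr e, hprod, lintegral_unif_exp_log_div (hl x)]
    calc _ ≤ ENNReal.ofReal (lam x / (lam x + 1)) * ∫⁻ b, ρ ^ N * h (zst x b) ∂μ := by
          exact mul_le_mul_right (lintegral_mono fun b => ih (zst x b)) _
      _ = ρ ^ N * (ENNReal.ofReal (lam x / (lam x + 1)) * ∫⁻ b, h (zst x b) ∂μ) := by
          rw [lintegral_const_mul _ (show Measurable fun b => h (zst x b) from hhm.comp (hz x))]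
          ring
      _ ≤ ρ ^ N * (ρ * h x) := by
          exact mul_le_mul_right (hh x) _
      _ = _ := by ring

/-- Markov's inequality applied to `exp(-T_N) h(Z_N)`, which is at least `exp(-y)` on the event
because `h ≥ 1`. -/
lemma measure_jtime_lt_le (hl : ∀ x, 0 < lam x) (hz : ∀ x, Measurable (zst x))
    {h : S → ℝ≥0∞} (h1 : ∀ x, 1 ≤ h x) {ρ : ℝ≥0∞}
    (hh : ∀ x, ENNReal.ofReal (lam x / (lam x + 1)) * ∫⁻ b, h (zst x b) ∂μ ≤ ρ * h x)
    (N : ℕ) (x : S) (y : ℝ) :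
    instrLaw μ {ω | jtime lam zst x ω N < y} ≤ ENNReal.ofReal (Real.exp y) * (ρ ^ N * h x) := by
  have hm : Measurable fun ω : ℕ → ℝ × β =>
      ENNReal.ofReal (Real.exp (-jtime lam zst x ω N)) * h (jchain zst x ω N) :=
    (ENNReal.measurable_ofReal.comp (Real.measurable_exp.comp (measurable_jtime hz x N).neg)).mul
      ((measurable_of_countable h).comp (measurable_jchain hz x N))
  have hM := (mul_meas_ge_le_lintegral hm (ENNReal.ofReal (Real.exp (-y)))).trans
    (lintegral_exp_neg_jtime_le hl hz hh N x)
  have hsub : {ω | jtime lam zst x ω N < y} ⊆ {ω | ENNReal.ofReal (Real.exp (-y)) ≤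
      ENNReal.ofReal (Real.exp (-jtime lam zst x ω N)) * h (jchain zst x ω N)} := by
    intro ω (hω : jtime lam zst x ω N < y)
    refine le_trans ?_ (mul_le_mul_right (h1 _) _)
    rw [mul_one]
    exact ENNReal.ofReal_le_ofReal (Real.exp_le_exp.2 (by linarith))
  calc _ ≤ 1 * instrLaw μ {ω | ENNReal.ofReal (Real.exp (-y)) ≤
      ENNReal.ofReal (Real.exp (-jtime lam zst x ω N)) * h (jchain zst x ω N)} := by
        rw [one_mul]; exact measure_mono hsub
    _ = ENNReal.ofReal (Real.exp y) * (ENNReal.ofReal (Real.exp (-y)) *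
          instrLaw μ {ω | ENNReal.ofReal (Real.exp (-y)) ≤
            ENNReal.ofReal (Real.exp (-jtime lam zst x ω N)) * h (jchain zst x ω N)}) := by
        rw [← mul_assoc, ← ENNReal.ofReal_mul (Real.exp_pos _).le, ← Real.exp_add]
        simp
    _ ≤ _ := by gcongr

lemma ae_mem_goodInstr (hl : ∀ x, 0 < lam x) (hz : ∀ x, Measurable (zst x))
    {h : S → ℝ≥0∞} (h1 : ∀ x, 1 ≤ h x) {ρ : ℝ≥0∞} (hρ : ρ < 1)
    (hh : ∀ x, ENNReal.ofReal (lam x / (lam x + 1)) * ∫⁻ b, h (zst x b) ∂μ ≤ ρ * h x)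
    {a : S} (ha : h a ≠ ∞) : ∀ᵐ ω ∂(instrLaw μ), ω ∈ goodInstr lam zst a := by
  have hk : ∀ k : ℕ, ∀ᵐ ω ∂(instrLaw μ), ∃ i, (k : ℝ) ≤ jtime lam zst a ω i := by
    intro k
    rw [ae_iff]
    have hb : ∀ N, instrLaw μ {ω | ¬ ∃ i, (k : ℝ) ≤ jtime lam zst a ω i} ≤
        ENNReal.ofReal (Real.exp k) * (ρ ^ N * h a) := fun N =>
      (measure_mono fun ω (hω : ¬ ∃ i, (k : ℝ) ≤ jtime lam zst a ω i) =>
        (not_le.1 fun h => hω ⟨N, h⟩ : jtime lam zst a ω N < k)).trans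
        (measure_jtime_lt_le hl hz h1 hh N a k)
    have hlim : Tendsto (fun N => ENNReal.ofReal (Real.exp k) * (ρ ^ N * h a)) atTop (𝓝 0) := by
      have h2 := ENNReal.tendsto_pow_atTop_nhds_zero_of_lt_one hρ
      have h3 := ENNReal.Tendsto.mul_const (b := h a) h2 (Or.inr ha)
      have h4 := ENNReal.Tendsto.const_mul (a := ENNReal.ofReal (Real.exp k)) h3
        (Or.inr ENNReal.ofReal_ne_top)
      simpa using h4
    exact nonpos_iff_eq_zero.1 (ge_of_tendsto' hlim hb)
  filter_upwards [ae_instrLaw_mem_Ioo μ, ae_all_iff.2 hk] with ω h2 h3 using ⟨h2, h3⟩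

/-- The event that one of the first `N` instructions is bad for the state in which it is used. -/
def failSet (zst : S → β → S) (bad : S → Set (ℝ × β)) (N : ℕ) (x : S) : Set (ℕ → ℝ × β) :=
  {ω | ∃ i < N, ω i ∈ bad (jchain zst x ω i)}

variable {bad : S → Set (ℝ × β)}

lemma measurableSet_failSet (hz : ∀ x, Measurable (zst x)) (hb : ∀ x, MeasurableSet (bad x))
    (N : ℕ) (x : S) : MeasurableSet (failSet zst bad N x) := by
  have : failSet zst bad N x =
      ⋃ i, ⋃ (_ : i < N), (fun ω => (jchain zst x ω i, ω i)) ⁻¹' {p | p.2 ∈ bad p.1} := by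
    ext ω
    simp [failSet]
  rw [this]
  refine MeasurableSet.iUnion fun i => MeasurableSet.iUnion fun _ => ?_
  refine ((measurable_jchain hz x i).prodMk (measurable_pi_apply i)) ?_
  have : {p : S × (ℝ × β) | p.2 ∈ bad p.1} = ⋃ y, {y} ×ˢ bad y := by
    ext p
    simp [mem_prod]
  rw [this]
  exact MeasurableSet.iUnion fun y => (measurableSet_singleton y).prod (hb y)

/-- Union bound along the chain. The set `A` need only be preserved by instructions that are not
bad, so leaving `A` can itself be declared bad. -/
lemma measure_failSet_le (hz : ∀ x, Measurable (zst x)) (hb : ∀ x, MeasurableSet (bad x))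
    {A : Set S} (hA : ∀ x ∈ A, ∀ p ∉ bad x, zst x p.2 ∈ A) {ε : ℝ≥0∞}
    (hε : ∀ x ∈ A, (unif.prod μ) (bad x) ≤ ε) (N : ℕ) (x : S) (hx : x ∈ A) :
    instrLaw μ (failSet zst bad N x) ≤ N * ε := by
  induction N generalizing x with
  | zero => simp [failSet]
  | succ N ih =>
    have hF := measurableSet_failSet (N := N) hz hb
    -- The first instruction is harmless and a failure occurs later, for the chain restarted at the
    -- new state.
    set T : Set ((ℝ × β) × (ℕ → ℝ × β)) :=
      {q | q.1 ∉ bad x} ∩ {q | q.2 ∈ failSet zst bad N (zst x q.1.2)} with hT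
    have hTm : MeasurableSet T := by
      refine MeasurableSet.inter (measurable_fst (hb x).compl) ?_
      have : {q : (ℝ × β) × (ℕ → ℝ × β) | q.2 ∈ failSet zst bad N (zst x q.1.2)} =
          ⋃ y, {q | zst x q.1.2 = y} ∩ {q | q.2 ∈ failSet zst bad N y} := by
        ext q
        simp
      rw [this]
      exact MeasurableSet.iUnion fun y => MeasurableSet.inter
        (((hz x).comp (measurable_snd.comp measurable_fst)) (measurableSet_singleton y))
        (measurable_snd (hF y))
    have hmp := measurePreserving_head_tail (unif.prod μ)
    have hsub : failSet zst bad (N + 1) x ⊆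
        (fun ω : ℕ → ℝ × β => (ω 0, fun i => ω (i + 1))) ⁻¹' (bad x ×ˢ univ ∪ T) := by
      rintro ω ⟨i, hi, hω⟩
      by_cases h0 : ω 0 ∈ bad x
      · exact Or.inl ⟨h0, trivial⟩
      · refine Or.inr ⟨h0, ?_⟩
        rcases i with _ | i
        · exact absurd hω h0
        · rw [jchain_succ'] at hω
          exact ⟨i, by omega, hω⟩
    calc instrLaw μ (failSet zst bad (N + 1) x)
        ≤ _ := measure_mono hsub
      _ = _ := hmp.measure_preimage
          (((hb x).prod MeasurableSet.univ).union hTm).nullMeasurableSet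
      _ ≤ ε + N * ε := by
          refine (measure_union_le _ _).trans (add_le_add ?_ ?_)
          · rw [Measure.prod_prod]
            simpa using hε x hx
          · rw [Measure.prod_apply hTm]
            refine (lintegral_mono (g := fun _ => N * ε) fun p => ?_).trans (by simp)
            by_cases hp : p ∈ bad x
            · simp [hT, hp]
            · refine le_trans (measure_mono fun q hq => ?_) (ih _ (hA x hx p hp))
              exact hq.2
      _ = _ := by push_cast; ring

end Tail

lemma jchain_mem_of_notMem_failSet {S β : Type*} {zst : S → β → S} {bad : S → Set (ℝ × β)}
    {A : Set S} (hA : ∀ x ∈ A, ∀ p ∉ bad x, zst x p.2 ∈ A)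
    {N : ℕ} {x : S} (hx : x ∈ A) {ω : ℕ → ℝ × β} (hω : ω ∉ failSet zst bad N x) :
    ∀ i ≤ N, jchain zst x ω i ∈ A := by
  intro i
  induction i with
  | zero => exact fun _ => hx
  | succ i ih => exact fun hi => hA _ (ih (by omega)) (ω i) fun h => hω ⟨i, by omega, h⟩

/-! ### Geometric against exponential waiting times -/

section WalkPath

variable {D β : Type*} {s : D → ℝ} {jmp : D → β → D}

lemma walk_eq_self {m : ℕ} {d : D} (h0 : 0 < s d) (h1 : s d < 1) :
    ∀ {u : ℝ} {p : β × (ℕ → ℝ × β)}, u < s d ^ m → walk s jmp m d (u, p) = d := by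
  induction m with
  | zero => intros; rfl
  | succ m ih =>
    intro u p hu
    have hu' : u < s d := hu.trans_le (pow_le_of_le_one h0.le h1.le (Nat.succ_ne_zero m))
    rw [walk, if_pos hu']
    exact ih (by rwa [div_lt_iff₀ h0, ← pow_succ])

/-- If `s^{G+1} ≤ u < s^G`, the walk stays `G` times and the jump is step number `G+1`; hence the
sums of `G j + 1` below. -/
lemma walk_add_of_pow {G : ℕ} (m : ℕ) {d : D} (h0 : 0 < s d) (h1 : s d < 1) :
    ∀ {u : ℝ} {b : β} {ω : ℕ → ℝ × β}, u < s d ^ G → s d ^ (G + 1) ≤ u →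
      walk s jmp (G + 1 + m) d (u, b, ω) = walk s jmp m (jmp d b) (headTail ω) := by
  induction G with
  | zero =>
    intro u b ω _ hu
    rw [zero_add, pow_one] at hu
    rw [zero_add, add_comm, walk, if_neg (not_lt.2 hu)]
    rfl
  | succ G ih =>
    intro u b ω hu hu2
    have hu' : u < s d := hu.trans_le (pow_le_of_le_one h0.le h1.le (Nat.succ_ne_zero G))
    rw [show G + 1 + 1 + m = (G + 1 + m) + 1 by ring, walk, if_pos hu']
    exact ih (by rwa [div_lt_iff₀ h0, ← pow_succ]) (by rwa [le_div_iff₀ h0, ← pow_succ])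

variable {d₀ : D} {ω : ℕ → ℝ × β} {N : ℕ} {G : ℕ → ℕ}

lemma walk_sum_add (h0 : ∀ i < N, 0 < s (jchain jmp d₀ ω i))
    (h1 : ∀ i < N, s (jchain jmp d₀ ω i) < 1)
    (hG : ∀ i < N, (ω i).1 < s (jchain jmp d₀ ω i) ^ G i)
    (hG' : ∀ i < N, s (jchain jmp d₀ ω i) ^ (G i + 1) ≤ (ω i).1) (i : ℕ) (hi : i ≤ N) (m : ℕ) :
    walk s jmp (∑ j ∈ Finset.range i, (G j + 1) + m) d₀ (headTail ω) =
      walk s jmp m (jchain jmp d₀ ω i) (headTail fun j => ω (i + j)) := by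
  induction i generalizing m with
  | zero => simp [jchain]
  | succ i ih =>
    have hi' : i < N := hi
    rw [Finset.sum_range_succ, add_assoc, ih hi'.le, headTail]
    refine (walk_add_of_pow m (h0 i hi') (h1 i hi') (hG i hi') (hG' i hi')).trans ?_
    rw [jchain]
    congr 2
    funext j
    congr 1
    ring

lemma walk_sum_add_eq (h0 : ∀ i < N, 0 < s (jchain jmp d₀ ω i))
    (h1 : ∀ i < N, s (jchain jmp d₀ ω i) < 1)
    (hG : ∀ i < N, (ω i).1 < s (jchain jmp d₀ ω i) ^ G i)
    (hG' : ∀ i < N, s (jchain jmp d₀ ω i) ^ (G i + 1) ≤ (ω i).1) (i : ℕ) (hi : i < N) (m : ℕ)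
    (hm : m ≤ G i) :
    walk s jmp (∑ j ∈ Finset.range i, (G j + 1) + m) d₀ (headTail ω) = jchain jmp d₀ ω i := by
  rw [walk_sum_add h0 h1 hG hG' i hi.le, headTail]
  exact walk_eq_self (h0 i hi) (h1 i hi)
    ((hG i hi).trans_le (pow_le_pow_of_le_one (h0 i hi).le (h1 i hi).le hm))

end WalkPath

lemma exists_pow_le_lt {s u : ℝ} (h1 : s < 1) (hu0 : 0 < u) (hu1 : u < 1) :
    ∃ G : ℕ, u < s ^ G ∧ s ^ (G + 1) ≤ u := by
  classical
  have hex : ∃ k : ℕ, s ^ k ≤ u := (exists_pow_lt_of_lt_one hu0 h1).imp fun _ h => h.le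
  have hne : Nat.find hex ≠ 0 := by
    intro h
    have := Nat.find_spec hex
    rw [h, pow_zero] at this
    linarith
  obtain ⟨G, hG⟩ := Nat.exists_eq_succ_of_ne_zero hne
  have := Nat.find_spec hex
  rw [hG] at this
  exact ⟨G, not_le.1 (Nat.find_min hex (by omega)), this⟩

/-- A geometric waiting time is close to the exponential waiting time it discretizes. -/
lemma abs_geom_sub_exp_le {δ l u : ℝ} (hδ : 0 < δ) (hl : 0 < l) (hx : δ * l < 1) {G : ℕ}
    (hu0 : 0 < u) (hG : u < (1 - δ * l) ^ G) (hG' : (1 - δ * l) ^ (G + 1) ≤ u) :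
    |δ * (G + 1 : ℕ) - -Real.log u / l| ≤ δ * (1 + -Real.log u) := by
  have hs : 0 < 1 - δ * l := by linarith
  have hxp : 0 < δ * l := by positivity
  -- With `E = -log u`, the hypotheses on `G` say `G c < E ≤ (G+1) c`, while `δ l ≤ c ≤ δ l / (1 - δ
  -- l)`.
  set c := -Real.log (1 - δ * l) with hc
  have hc1 : δ * l ≤ c := by have := Real.log_le_sub_one_of_pos hs; linarith
  have hc2 : c * (1 - δ * l) ≤ δ * l := by
    have := Real.log_le_sub_one_of_pos (inv_pos.2 hs)
    rw [Real.log_inv, ← hc] at this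
    have h3 := mul_le_mul_of_nonneg_right this hs.le
    rw [sub_mul, inv_mul_cancel₀ hs.ne'] at h3
    linarith
  have hG1 := Real.log_lt_log hu0 hG
  have hG2 := Real.log_le_log (pow_pos hs _) hG'
  rw [Real.log_pow] at hG1 hG2
  set E := -Real.log u with hE
  have a1 : G * c < E := by linarith
  have a2 : E ≤ (G + 1 : ℕ) * c := by linarith
  push_cast at a2 ⊢
  have hG0 : (0 : ℝ) ≤ G := Nat.cast_nonneg G
  have hE0 : 0 ≤ E := by nlinarith
  have b1 : δ * G ≤ E / l := by
    rw [le_div_iff₀ hl]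
    nlinarith
  have b2 : E / l - δ * E ≤ δ * (G + 1) := by
    have : E * (1 - δ * l) ≤ (G + 1) * (δ * l) := by nlinarith
    rw [show E / l - δ * E = E * (1 - δ * l) / l by field_simp, div_le_iff₀ hl]
    linarith
  rw [abs_le]
  constructor <;> nlinarith

/-- A step path `F ⌊c t⌋` changes exactly at times of the form `m / c`, so a discrete change at `σ
i` occurs at time `σ i / c`. -/
lemma jumpTime_floor {F : ℕ → ℝ} {c : ℝ} (hc : 0 < c) {σ : ℕ → ℕ} {N : ℕ} (h0 : σ 0 = 0)
    (hlt : ∀ i < N, σ i < σ (i + 1))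
    (hF : ∀ i < N, ∀ m, σ i ≤ m → m < σ (i + 1) → F m = F (σ i))
    (hne : ∀ i < N, F (σ (i + 1)) ≠ F (σ i)) (i : ℕ) (hi : i ≤ N) :
    jumpTime (fun t : ℝ≥0 => F ⌊c * (t : ℝ)⌋₊) i = ((σ i / c : ℝ).toNNReal : ℝ≥0∞) ∧
      embedded (fun t : ℝ≥0 => F ⌊c * (t : ℝ)⌋₊) i = F (σ i) := by
  have hco : ∀ i, (((σ i / c : ℝ).toNNReal : ℝ≥0) : ℝ) = σ i / c := fun i =>
    Real.coe_toNNReal _ (by positivity)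
  have hv : ∀ i, ⌊c * (((σ i / c : ℝ).toNNReal : ℝ≥0) : ℝ)⌋₊ = σ i := fun i => by
    rw [hco, mul_div_cancel₀ _ hc.ne', Nat.floor_natCast]
  have key := jumpTime_eq (f := fun t : ℝ≥0 => F ⌊c * (t : ℝ)⌋₊)
    (t := fun i => (σ i / c : ℝ).toNNReal) (N := N) (by simp [h0]) ?_ ?_ ?_ i hi
  · refine ⟨key, ?_⟩
    rw [embedded, key, ENNReal.toNNReal_coe, hv]
  · intro i hi
    refine (Real.toNNReal_lt_toNNReal_iff_of_nonneg (by positivity)).2 ?_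
    exact div_lt_div_of_pos_right (by exact_mod_cast hlt i hi) hc
  · intro i hi t h1 h2
    simp only [hv]
    rw [← NNReal.coe_le_coe, hco, div_le_iff₀ hc] at h1
    rw [← NNReal.coe_lt_coe, hco, lt_div_iff₀ hc] at h2
    refine hF i hi _ (Nat.le_floor (by linarith)) ?_
    exact (Nat.floor_lt (by positivity)).2 (by linarith)
  · intro i hi
    simp only [hv]
    exact hne i hi

lemma unif_ite_eq {S : Type*} [DecidableEq S] {π : ℝ} (hπ : π ∈ Icc (0 : ℝ) 1) (y z x : S) :
    unif {u | (if u < π then y else z) = x} =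
      (if x = y then ENNReal.ofReal π else 0) + (if x = z then ENNReal.ofReal (1 - π) else 0) := by
  have h1 := unif_Iio hπ.2
  have h2 := unif_Ici hπ.1 hπ.2
  by_cases hy : x = y <;> by_cases hz : x = z
  · have : {u | (if u < π then y else z) = x} = univ := by
      ext u; simp [← hy, ← hz]
    rw [this, if_pos hy, if_pos hz, ← ENNReal.ofReal_add hπ.1 (by linarith [hπ.2])]
    simp
  · have : {u | (if u < π then y else z) = x} = Iio π := by
      ext u; simp only [mem_ofPred_eq, mem_Iio]; grind
    rw [this, if_pos hy, if_neg hz, h1, add_zero]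
  · have : {u | (if u < π then y else z) = x} = Ici π := by
      ext u; simp only [mem_ofPred_eq, mem_Ici]; grind
    rw [this, if_neg hy, if_pos hz, h2, zero_add]
  · have : {u | (if u < π then y else z) = x} = ∅ := by
      ext u; by_cases hu : u < π <;> simp [hu, Ne.symm hz, Ne.symm hy]
    rw [this, if_neg hy, if_neg hz, measure_empty, add_zero]

/-! ### The walk on `ℤ + 1/2` and its Lyapunov function -/

section HalfInt

instance : Countable HalfInt := by
  refine Function.Surjective.countable (α := ℤ) (f := fun k => ⟨(k : ℝ) + 1 / 2, k, rfl⟩) ?_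
  rintro ⟨x, k, hk⟩
  exact ⟨k, Subtype.ext hk.symm⟩

/-- The right neighbour. -/
noncomputable def halfUp (x : HalfInt) : HalfInt :=
  ⟨x + 1, by obtain ⟨k, hk⟩ := x.2; exact ⟨k + 1, by rw [hk]; push_cast; ring⟩⟩

/-- The left neighbour. -/
noncomputable def halfDown (x : HalfInt) : HalfInt :=
  ⟨x - 1, by obtain ⟨k, hk⟩ := x.2; exact ⟨k - 1, by rw [hk]; push_cast; ring⟩⟩

/-- The total jump rate at `x`. -/
noncomputable def totalRate (q x : ℝ) : ℝ := q ^ x + q ^ (-x)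

/-- The probability to jump up from `x`. -/
noncomputable def upProb (q x : ℝ) : ℝ := q ^ (-x) / totalRate q x

/-- The randomness of a jump: the direction, the success of the coupling, and an additional
uniform variable. -/
abbrev JumpRand : Type := (ℝ × ℝ) × unitInterval

/-- The law of the randomness of a jump. -/
noncomputable def jumpRandLaw : Measure JumpRand := (unif.prod unif).prod volume

instance : IsProbabilityMeasure jumpRandLaw := by unfold jumpRandLaw; infer_instance

/-- The jumps of the walk on `ℤ + 1/2`. -/
noncomputable def halfStep (q : ℝ) (x : HalfInt) (b : JumpRand) : HalfInt :=
  if b.1.1 < upProb q x then halfUp x else halfDown x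

variable {q : ℝ}

lemma totalRate_pos (hq : 0 < q) (x : ℝ) : 0 < totalRate q x := by
  unfold totalRate; positivity

lemma upProb_mem (hq : 0 < q) (x : ℝ) : upProb q x ∈ Icc (0 : ℝ) 1 := by
  have h := totalRate_pos hq x
  refine ⟨by unfold upProb; positivity, ?_⟩
  rw [upProb, div_le_one h, totalRate]
  linarith [Real.rpow_pos_of_pos hq x]

lemma one_sub_upProb (hq : 0 < q) (x : ℝ) : 1 - upProb q x = q ^ x / totalRate q x := by
  have h := (totalRate_pos hq x).ne'
  rw [upProb, eq_div_iff h, sub_mul, div_mul_cancel₀ _ h, totalRate]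
  ring

lemma halfStep_ne (x : HalfInt) (b : JumpRand) : halfStep q x b ≠ x := by
  intro h
  have h := congrArg Subtype.val h
  unfold halfStep halfUp halfDown at h
  split_ifs at h <;> simp at h

lemma measurable_halfStep (x : HalfInt) : Measurable (halfStep q x) :=
  Measurable.ite (measurableSet_lt (measurable_fst.comp measurable_fst) measurable_const)
    measurable_const measurable_const

lemma measurePreserving_jumpRand_dir :
    MeasurePreserving (fun b : JumpRand => b.1.1) jumpRandLaw unif :=
  measurePreserving_fst.comp measurePreserving_fst

lemma measurePreserving_jumpRand_match :
    MeasurePreserving (fun b : JumpRand => b.1.2) jumpRandLaw unif :=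
  measurePreserving_snd.comp measurePreserving_fst

open Classical in
lemma measure_halfStep_eq (hq : 0 < q) (x y : HalfInt) :
    jumpRandLaw {b | halfStep q x b = y} =
      (if y = halfUp x then ENNReal.ofReal (upProb q x) else 0) +
        (if y = halfDown x then ENNReal.ofReal (1 - upProb q x) else 0) := by
  rw [← unif_ite_eq (upProb_mem hq x)]
  refine measurePreserving_jumpRand_dir.measure_preimage (s :=
    {u | (if u < upProb q x then halfUp x else halfDown x) = y}) ?_
  exact ((Measurable.ite measurableSet_Iio measurable_const measurable_const)
    (measurableSet_singleton y)).nullMeasurableSet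

lemma oddRate_self (x : HalfInt) : oddRate q x x = -totalRate q x := by
  simp only [oddRate, totalRate]
  rw [if_neg (by simp), if_neg (by intro h; linarith), if_pos trivial]
  ring

lemma measureReal_halfStep_eq (hq : 0 < q) (x y : HalfInt) (hxy : x ≠ y) :
    jumpRandLaw.real {b | halfStep q x b = y} = oddRate q x y / totalRate q x := by
  rw [Measure.real, measure_halfStep_eq hq]
  have e1 : y = halfUp x ↔ (y : ℝ) = x + 1 := Subtype.ext_iff
  have e2 : y = halfDown x ↔ (y : ℝ) = x - 1 := Subtype.ext_iff
  have hp := upProb_mem hq x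
  unfold oddRate
  by_cases h1 : (y : ℝ) = x + 1
  · have h2 : ¬ (y : ℝ) = x - 1 := by intro h; linarith
    rw [if_pos (e1.2 h1), if_neg (e2.not.2 h2), if_pos h1, add_zero, ENNReal.toReal_ofReal hp.1]
    rfl
  · by_cases h2 : (y : ℝ) = x - 1
    · rw [if_neg (e1.not.2 h1), if_pos (e2.2 h2), if_neg h1, if_pos h2, zero_add,
        ENNReal.toReal_ofReal (by linarith [hp.2]), one_sub_upProb hq]
    · rw [if_neg (e1.not.2 h1), if_neg (e2.not.2 h2), if_neg h1, if_neg h2, if_neg hxy]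
      simp

lemma lintegral_halfStep (hq : 0 < q) (h : HalfInt → ℝ≥0∞) (x : HalfInt) :
    ∫⁻ b, h (halfStep q x b) ∂jumpRandLaw =
      ENNReal.ofReal (upProb q x) * h (halfUp x) +
        ENNReal.ofReal (1 - upProb q x) * h (halfDown x) := by
  rw [← lintegral_map (measurable_of_countable h) (measurable_halfStep x), lintegral_countable']
  have hs : ∀ y, jumpRandLaw.map (halfStep q x) {y} = jumpRandLaw {b | halfStep q x b = y} :=
    fun y => Measure.map_apply (measurable_halfStep x) (measurableSet_singleton y)
  simp only [hs, measure_halfStep_eq hq, mul_add, mul_ite, mul_zero]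
  rw [ENNReal.tsum_add, tsum_ite_eq, tsum_ite_eq, mul_comm, mul_comm (h (halfDown x))]

lemma half_le_abs (x : HalfInt) : 1 / 2 ≤ |(x : ℝ)| := by
  obtain ⟨k, hk⟩ := x.2
  rw [hk]
  rcases le_or_gt 0 k with h | h
  · have : (0 : ℝ) ≤ k := by exact_mod_cast h
    exact le_trans (by linarith) (le_abs_self _)
  · have : (k : ℝ) ≤ -1 := by exact_mod_cast Int.le_sub_one_of_lt h
    exact le_trans (by linarith) (neg_le_abs _)

lemma three_half_le_of_half_lt (x : HalfInt) (h : 1 / 2 < (x : ℝ)) : 3 / 2 ≤ (x : ℝ) := by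
  obtain ⟨k, hk⟩ := x.2
  rw [hk] at h ⊢
  have : (0 : ℝ) < k := by linarith
  have : 0 < k := by exact_mod_cast this
  have : (1 : ℝ) ≤ k := by exact_mod_cast this
  linarith

/-- The spectral gap used for the waiting times of the walk. -/
noncomputable def gap (q : ℝ) : ℝ := (1 - (q ^ (1 / 2 : ℝ))⁻¹) / (3 * q)

lemma gap_pos (hq : 1 < q) : 0 < gap q := by
  have h1 : 1 < q ^ (1 / 2 : ℝ) := Real.one_lt_rpow hq (by norm_num)
  have := inv_lt_one_of_one_lt₀ h1
  exact div_pos (by linarith) (by linarith)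

lemma gap_lt_one (hq : 1 < q) : gap q < 1 := by
  have : 0 < (q ^ (1 / 2 : ℝ))⁻¹ := by positivity
  rw [gap, div_lt_one (by linarith)]
  linarith

/-- The drift inequality at height `y > 1/2`, with `s = q^{1/2}`, `t = q^y`, after division by
`q^{y/2}`: outward jumps cost a factor `s` but have rate `t⁻¹`, inward ones gain `s⁻¹` at rate `t`.
-/
lemma lyapunov_far {s t : ℝ} (hs : 1 < s) (ht : s ≤ t) :
    s * t⁻¹ + s⁻¹ * t ≤ (1 - (1 - s⁻¹) / (3 * s ^ 2)) * (t + t⁻¹ + 1) := by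
  have hs0 : 0 < s := by linarith
  have ht0 : 0 < t := by linarith
  have h1 : t⁻¹ ≤ s⁻¹ := inv_anti₀ hs0 ht
  have h2 : s⁻¹ < 1 := inv_lt_one_of_one_lt₀ hs
  have h3 : s * s⁻¹ = 1 := mul_inv_cancel₀ hs0.ne'
  have h4 : 0 < t⁻¹ := by positivity
  have h5 : (1 - s⁻¹) / (3 * s ^ 2) * (t + t⁻¹ + 1) ≤ (1 - s⁻¹) * t := by
    rw [div_mul_eq_mul_div, div_le_iff₀ (by positivity), mul_assoc]
    refine mul_le_mul_of_nonneg_left ?_ (by linarith)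
    have : t * (3 * 1) ≤ t * (3 * s ^ 2) := by gcongr; nlinarith
    linarith
  have h6 : (s - 1) * t⁻¹ ≤ (s - 1) * s⁻¹ := mul_le_mul_of_nonneg_left h1 (by linarith)
  have h7 : 0 < s⁻¹ := by positivity
  nlinarith

/-- The case `y = 1/2`, where the inward jump leads to `-1/2` and `|x|` does not decrease; the `+ 1`
coming from the holding time still makes the inequality strict enough. -/
lemma lyapunov_near {s : ℝ} (hs : 1 < s) :
    s * s⁻¹ + s ≤ (1 - (1 - s⁻¹) / (3 * s ^ 2)) * (s + s⁻¹ + 1) := by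
  have hs0 : 0 < s := by linarith
  have h2 : s⁻¹ < 1 := inv_lt_one_of_one_lt₀ hs
  have h3 : s * s⁻¹ = 1 := mul_inv_cancel₀ hs0.ne'
  have h7 : 0 < s⁻¹ := by positivity
  have h5 : (1 - s⁻¹) / (3 * s ^ 2) * (s + s⁻¹ + 1) ≤ s⁻¹ := by
    rw [div_mul_eq_mul_div, div_le_iff₀ (by positivity)]
    have : s⁻¹ * (3 * s ^ 2) = 3 * s := by rw [pow_two]; linear_combination 3 * s * h3
    rw [this]
    nlinarith
  nlinarith

lemma lyapunov_aux (hq : 1 < q) {y z w : ℝ} (hy : 1 / 2 ≤ y) (hz : z = y + 1)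
    (hw : w = y - 1 ∨ y = 1 / 2 ∧ w = y) :
    q ^ (-y) * q ^ (z / 2) + q ^ y * q ^ (w / 2) ≤
      (1 - gap q) * (q ^ y + q ^ (-y) + 1) * q ^ (y / 2) := by
  have hq0 : 0 < q := by linarith
  have hs : 1 < q ^ (1 / 2 : ℝ) := Real.one_lt_rpow hq (by norm_num)
  have hgap : gap q = (1 - (q ^ (1 / 2 : ℝ))⁻¹) / (3 * (q ^ (1 / 2 : ℝ)) ^ 2) := by
    rw [gap, ← Real.rpow_natCast (q ^ (1 / 2 : ℝ)), ← Real.rpow_mul hq0.le]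
    norm_num
  have ht : q ^ (1 / 2 : ℝ) ≤ q ^ y := Real.rpow_le_rpow_of_exponent_le hq.le hy
  have ez : q ^ (z / 2) = q ^ (1 / 2 : ℝ) * q ^ (y / 2) := by
    rw [← Real.rpow_add hq0, hz]; congr 1; ring
  have hp : 0 < q ^ (y / 2) := by positivity
  rw [ez, hgap, Real.rpow_neg hq0.le]
  rcases hw with hw | ⟨hy2, hw⟩
  · have ew : q ^ (w / 2) = (q ^ (1 / 2 : ℝ))⁻¹ * q ^ (y / 2) := by
      rw [← Real.rpow_neg hq0.le, ← Real.rpow_add hq0, hw]; congr 1; ring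
    rw [ew]
    have := mul_le_mul_of_nonneg_right (lyapunov_far hs ht) hp.le
    linarith
  · rw [hw, hy2]
    have := mul_le_mul_of_nonneg_right (lyapunov_near hs) hp.le
    rw [hy2] at this
    linarith

lemma halfStep_lyapunov (hq : 1 < q) (x : HalfInt) :
    ENNReal.ofReal (totalRate q x / (totalRate q x + 1)) *
      ∫⁻ b, ENNReal.ofReal (q ^ (|(halfStep q x b : ℝ)| / 2)) ∂jumpRandLaw ≤
        ENNReal.ofReal (1 - gap q) * ENNReal.ofReal (q ^ (|(x : ℝ)| / 2)) := by
  have hq0 : 0 < q := by linarith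
  have hl := totalRate_pos hq0 x
  have hp := upProb_mem hq0 x
  have hg := gap_lt_one hq
  have key : q ^ (-(x : ℝ)) * q ^ (|(x : ℝ) + 1| / 2) + q ^ (x : ℝ) * q ^ (|(x : ℝ) - 1| / 2) ≤
      (1 - gap q) * (totalRate q x + 1) * q ^ (|(x : ℝ)| / 2) := by
    have hx := half_le_abs x
    rcases le_or_gt 0 (x : ℝ) with h0 | h0
    · rw [abs_of_nonneg h0] at hx ⊢
      refine lyapunov_aux hq hx (abs_of_nonneg (by linarith)) ?_
      rcases hx.eq_or_lt with h | h
      · right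
        rw [← h]
        norm_num [abs_of_neg]
      · left
        exact abs_of_nonneg (by linarith [three_half_le_of_half_lt x h])
    · rw [abs_of_neg h0] at hx ⊢
      have hd : (halfDown x : ℝ) = x - 1 := rfl
      have := lyapunov_aux hq (y := -x) (z := |(x : ℝ) - 1|) (w := |(x : ℝ) + 1|) hx
        (by rw [abs_of_neg (by linarith)]; ring) ?_
      · rw [neg_neg] at this
        rw [totalRate, add_comm (q ^ (x : ℝ))]
        linarith
      · obtain ⟨k, hk⟩ := x.2
        rcases hx.eq_or_lt with h | h
        · right
          refine ⟨h.symm, ?_⟩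
          rw [abs_of_nonneg (by linarith)]
          linarith
        · left
          have : (k : ℝ) < -1 := by linarith
          have : k < -1 := by exact_mod_cast this
          have : (k : ℝ) ≤ -2 := by exact_mod_cast Int.le_sub_one_of_lt this
          rw [abs_of_neg (by linarith)]
          ring
  rw [lintegral_halfStep hq0 fun y => ENNReal.ofReal (q ^ (|(y : ℝ)| / 2)), ← ENNReal.ofReal_mul hp.1, ← ENNReal.ofReal_mul (by linarith [hp.2]),
    ← ENNReal.ofReal_add (mul_nonneg hp.1 (by positivity))
      (mul_nonneg (by linarith [hp.2]) (by positivity)),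
    ← ENNReal.ofReal_mul (by positivity), ← ENNReal.ofReal_mul (by linarith)]
  refine ENNReal.ofReal_le_ofReal ?_
  have e : ∀ l a b U D : ℝ, 0 < l →
      l / (l + 1) * (a / l * U + b / l * D) = (a * U + b * D) / (l + 1) := by
    intro l a b U D hl
    field_simp
  rw [one_sub_upProb hq0, upProb, e _ _ _ _ _ hl, div_le_iff₀ (by linarith)]
  simp only [halfUp, halfDown]
  linarith

lemma one_le_ofReal_rpow_abs (hq : 1 < q) (x : HalfInt) :
    1 ≤ ENNReal.ofReal (q ^ (|(x : ℝ)| / 2)) := by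
  rw [← ENNReal.ofReal_one]
  exact ENNReal.ofReal_le_ofReal (Real.one_le_rpow hq.le (by positivity))

end HalfInt

/-! ### Splitting the two step matrix into ideal and residual jumps -/

section RankJump

/-- The states of the chain for which the coupling is attempted. -/
def inZone (q : ℝ) (n : ℕ) (B : ℝ) (d : Fin (n + 1)) : Prop :=
  |(d : ℝ) - n / 2| ≤ B ∧ 3 * q * q ^ (-(n : ℝ) / 2 + B) ≤ 1

/-- The probability that the coupling of a jump fails. -/
noncomputable def failProb (q : ℝ) (n : ℕ) (B : ℝ) : ℝ := 3 * q * q ^ (-(n : ℝ) / 2 + B)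

/-- The time which corresponds to two steps of the chain. -/
noncomputable def cellLen (q : ℝ) (n : ℕ) : ℝ := q ^ (-(n : ℝ) / 2) / (q - 1)

open Classical in
/-- The probability to stay put used in the coupling. -/
noncomputable def stayProb (q : ℝ) (n : ℕ) (B : ℝ) (d : Fin (n + 1)) : ℝ :=
  if inZone q n B d then 1 - cellLen q n * totalRate q ((d : ℝ) - n / 2) else 0

/-- The next state. -/
def finUp {n : ℕ} (d : Fin (n + 1)) : Fin (n + 1) := ⟨min (d + 1) n, by omega⟩

/-- The previous state. -/
def finDown {n : ℕ} (d : Fin (n + 1)) : Fin (n + 1) := ⟨d - 1, by omega⟩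

/-- The jump distribution of the limiting walk. -/
noncomputable def idealJump (q : ℝ) {n : ℕ} (d x : Fin (n + 1)) : ℝ :=
  (if x = finUp d then upProb q ((d : ℝ) - n / 2) else 0) +
    (if x = finDown d then 1 - upProb q ((d : ℝ) - n / 2) else 0)

open Classical in
/-- The jump distribution if the coupling fails or is not attempted. -/
noncomputable def residualJump (q : ℝ) (n : ℕ) (B : ℝ) (d x : Fin (n + 1)) : ℝ :=
  if inZone q n B d then
    (rankP₂ q n d x - (if x = d then stayProb q n B d else 0) -
      (1 - stayProb q n B d) * (1 - failProb q n B) * idealJump q d x) /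
        ((1 - stayProb q n B d) * failProb q n B)
  else rankP₂ q n d x

open Classical in
/-- The jumps of the chain. -/
noncomputable def rankJump (q : ℝ) (n : ℕ) (B : ℝ) (g : Fin (n + 1) → unitInterval → Fin (n + 1))
    (d : Fin (n + 1)) (b : JumpRand) : Fin (n + 1) :=
  if inZone q n B d ∧ b.1.2 < 1 - failProb q n B then
    (if b.1.1 < upProb q ((d : ℝ) - n / 2) then finUp d else finDown d)
  else g d b.2

variable {q : ℝ} {n : ℕ} {B : ℝ} {d : Fin (n + 1)}

lemma cellLen_pos (hq : 2 ≤ q) : 0 < cellLen q n := by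
  have : 0 < q - 1 := by linarith
  unfold cellLen
  positivity

lemma cellLen_le (hq : 2 ≤ q) : cellLen q n ≤ q ^ (-(n : ℝ) / 2) :=
  div_le_self (by positivity) (by linarith)

lemma failProb_pos (hq : 2 ≤ q) : 0 < failProb q n B := by
  unfold failProb
  positivity

lemma cellLen_mul_rpow_le (hq : 2 ≤ q) {z : ℝ} (hz : z ≤ B) :
    cellLen q n * q ^ z ≤ q ^ (-(n : ℝ) / 2 + B) := by
  rw [Real.rpow_add (by linarith)]
  exact mul_le_mul (cellLen_le hq) (Real.rpow_le_rpow_of_exponent_le (by linarith) hz)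
    (by positivity) (by positivity)

lemma cellLen_mul_totalRate_lt (hq : 2 ≤ q) (hd : inZone q n B d) :
    cellLen q n * totalRate q ((d : ℝ) - n / 2) < 1 := by
  have h1 := cellLen_mul_rpow_le (n := n) hq (abs_le.1 hd.1).2
  have h2 := cellLen_mul_rpow_le (n := n) hq (neg_le.1 (abs_le.1 hd.1).1)
  have h3 := hd.2
  have h4 : 0 < q ^ (-(n : ℝ) / 2 + B) := by positivity
  rw [totalRate, mul_add]
  nlinarith

lemma stayProb_of_inZone (hd : inZone q n B d) :
    stayProb q n B d = 1 - cellLen q n * totalRate q ((d : ℝ) - n / 2) := if_pos hd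

lemma stayProb_mem (hq : 2 ≤ q) (d : Fin (n + 1)) : stayProb q n B d ∈ Icc (0 : ℝ) 1 := by
  unfold stayProb
  split_ifs with hd
  · have h1 := cellLen_mul_totalRate_lt hq hd
    have h2 := mul_pos (cellLen_pos hq (n := n)) (totalRate_pos (show 0 < q by linarith)
      ((d : ℝ) - n / 2))
    constructor <;> linarith
  · simp

lemma finUp_val (hB : B < n / 2) (hd : inZone q n B d) : (finUp d : ℕ) = d + 1 := by
  have h1 := (abs_le.1 hd.1).2
  have h2 : (d : ℝ) < n := by linarith
  have h3 : (d : ℕ) < n := by exact_mod_cast h2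
  simp only [finUp]
  omega

lemma finDown_val (hB : B < n / 2) (hd : inZone q n B d) : (finDown d : ℕ) + 1 = d := by
  have h1 := (abs_le.1 hd.1).1
  have h2 : (0 : ℝ) < d := by linarith
  have h3 : 0 < (d : ℕ) := by exact_mod_cast h2
  simp only [finDown]
  omega

lemma idealJump_nonneg (hq : 2 ≤ q) (d x : Fin (n + 1)) : 0 ≤ idealJump q d x := by
  have h := upProb_mem (show 0 < q by linarith) ((d : ℝ) - n / 2)
  unfold idealJump
  refine add_nonneg ?_ ?_ <;> split_ifs <;> linarith [h.1, h.2]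

lemma sum_idealJump (d : Fin (n + 1)) : ∑ x, idealJump q d x = 1 := by
  simp [idealJump, Finset.sum_add_distrib]

/-- This is where the three lower bounds on `rankP₂` enter, one for each of `d`, `finUp d`, `finDown
d`; at other states nothing is subtracted. -/
lemma residualJump_nonneg (hq : 2 ≤ q) (hB : B < n / 2) (d x : Fin (n + 1)) :
    0 ≤ residualJump q n B d x := by
  have hq0 : 0 < q := by linarith
  rw [residualJump]
  by_cases hd : inZone q n B d
  swap
  · rw [if_neg hd]
    exact rankP₂_nonneg (by linarith) n d x
  rw [if_pos hd]
  have hη := failProb_pos hq (n := n) (B := B)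
  have hs := stayProb_mem hq (B := B) d
  refine div_nonneg ?_ (mul_nonneg (by linarith [hs.2]) hη.le)
  have hz : (d : ℝ) = n / 2 + ((d : ℝ) - n / 2) := by ring
  have hu := finUp_val hB hd
  have hw := finDown_val hB hd
  have hl := totalRate_pos hq0 ((d : ℝ) - n / 2)
  have hud : finUp d ≠ d := fun h => by rw [h] at hu; omega
  have hwd : finDown d ≠ d := fun h => by rw [h] at hw; omega
  have huw : finUp d ≠ finDown d := fun h => by rw [h] at hu; omega
  -- Since `1 - stayProb` is `cellLen` times the total rate, the total rate cancels against the
  -- denominator of `upProb`.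
  have e1 : (1 - stayProb q n B d) * (1 - failProb q n B) * upProb q ((d : ℝ) - n / 2) =
      cellLen q n * q ^ (-((d : ℝ) - n / 2)) * (1 - failProb q n B) := by
    rw [stayProb_of_inZone hd, upProb]
    generalize totalRate q ((d : ℝ) - n / 2) = l at hl
    field_simp
    ring
  have e2 : (1 - stayProb q n B d) * (1 - failProb q n B) * (1 - upProb q ((d : ℝ) - n / 2)) =
      cellLen q n * q ^ ((d : ℝ) - n / 2) * (1 - failProb q n B) := by
    rw [stayProb_of_inZone hd, one_sub_upProb hq0]
    generalize totalRate q ((d : ℝ) - n / 2) = l at hl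
    field_simp
    ring
  unfold idealJump
  by_cases h1 : x = d
  · rw [if_pos h1, if_neg (h1 ▸ hud.symm), if_neg (h1 ▸ hwd.symm), h1, stayProb_of_inZone hd]
    have := le_rankP₂_self hq hz
    unfold cellLen totalRate
    linarith
  · rw [if_neg h1]
    by_cases h2 : x = finUp d
    · rw [if_pos h2, if_neg (h2 ▸ huw), add_zero, e1]
      have := le_rankP₂_succ hq hz hd.1 hd.2 (x := x) (h2 ▸ hu)
      unfold cellLen failProb
      linarith
    · rw [if_neg h2]
      by_cases h3 : x = finDown d
      · rw [if_pos h3, zero_add, e2]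
        have := le_rankP₂_pred hq hz hd.1 hd.2 (x := x) (h3 ▸ hw)
        unfold cellLen failProb
        linarith
      · rw [if_neg h3]
        have := rankP₂_nonneg (show 1 < q by linarith) n d x
        linarith

lemma one_sub_stayProb_pos (hq : 2 ≤ q) (hd : inZone q n B d) : 0 < 1 - stayProb q n B d := by
  rw [stayProb_of_inZone hd, sub_sub_cancel]
  exact mul_pos (cellLen_pos hq) (totalRate_pos (by linarith) _)

lemma sum_residualJump (hq : 2 ≤ q) (d : Fin (n + 1)) : ∑ x, residualJump q n B d x = 1 := by
  have hP := sum_rankP₂ (show 1 < q by linarith) n d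
  unfold residualJump
  split_ifs with hd
  · have h1 := one_sub_stayProb_pos hq hd
    have h2 := failProb_pos hq (n := n) (B := B)
    rw [← Finset.sum_div, Finset.sum_sub_distrib, Finset.sum_sub_distrib, hP, ← Finset.mul_sum,
      sum_idealJump, Finset.sum_ite_eq', if_pos (Finset.mem_univ d),
      div_eq_one_iff_eq (by positivity)]
    ring
  · exact hP

variable {g : Fin (n + 1) → unitInterval → Fin (n + 1)}

lemma measurable_rankJump (hg : ∀ d, Measurable (g d)) (d : Fin (n + 1)) :
    Measurable (rankJump q n B g d) := by
  classical
  refine Measurable.ite ?_ ?_ ((hg d).comp measurable_snd)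
  · exact (MeasurableSet.const _).inter
      (measurableSet_lt (measurable_snd.comp measurable_fst) measurable_const)
  · exact Measurable.ite (measurableSet_lt (measurable_fst.comp measurable_fst) measurable_const)
      measurable_const measurable_const

lemma measure_rankJump_of_inZone (hq : 2 ≤ q) (hg : ∀ d, Measurable (g d))
    (hgv : ∀ d x, volume (g d ⁻¹' {x}) = ENNReal.ofReal (residualJump q n B d x))
    (hd : inZone q n B d) (x : Fin (n + 1)) :
    jumpRandLaw {b | rankJump q n B g d b = x} =
      ENNReal.ofReal (idealJump q d x) * ENNReal.ofReal (1 - failProb q n B) +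
        ENNReal.ofReal (failProb q n B) * ENNReal.ofReal (residualJump q n B d x) := by
  have hη0 := failProb_pos hq (n := n) (B := B)
  have hη1 : failProb q n B ≤ 1 := hd.2
  have hπ := upProb_mem (show 0 < q by linarith) ((d : ℝ) - n / 2)
  set A : Set ℝ := {u | (if u < upProb q ((d : ℝ) - n / 2) then finUp d else finDown d) = x} with hA
  have hAm : MeasurableSet A := (Measurable.ite measurableSet_Iio measurable_const
    measurable_const : Measurable fun u => if u < upProb q ((d : ℝ) - n / 2) then finUp d
      else finDown d) (measurableSet_singleton x)
  have hset : {b | rankJump q n B g d b = x} = (A ×ˢ Iio (1 - failProb q n B)) ×ˢ univ ∪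
      (univ ×ˢ Ici (1 - failProb q n B)) ×ˢ (g d ⁻¹' {x}) := by
    ext b
    by_cases hb : b.1.2 < 1 - failProb q n B
    · have hb' : ¬ 1 - failProb q n B ≤ b.1.2 := not_le.2 hb
      simp only [rankJump, hd, hb, hA, hb', mem_union, mem_prod, mem_Ici, mem_Iio, mem_ofPred_eq,
        mem_univ, mem_preimage, and_true, and_false, false_and, or_false, if_true, true_and]
    · simp [rankJump, hd, hb, not_lt.1 hb]
  have hdisj : Disjoint ((A ×ˢ Iio (1 - failProb q n B)) ×ˢ (univ : Set unitInterval))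
      ((univ ×ˢ Ici (1 - failProb q n B)) ×ˢ (g d ⁻¹' {x})) := by
    rw [Set.disjoint_left]
    rintro b ⟨⟨_, h1⟩, _⟩ ⟨⟨_, h2⟩, _⟩
    exact absurd (mem_Iio.1 h1) (not_lt.2 h2)
  rw [hset, measure_union hdisj
    ((MeasurableSet.univ.prod measurableSet_Ici).prod (hg d (measurableSet_singleton x))),
    jumpRandLaw, Measure.prod_prod, Measure.prod_prod, Measure.prod_prod, Measure.prod_prod,
    measure_univ, measure_univ, mul_one, one_mul, hgv, unif_Iio (by linarith),
    unif_Ici (by linarith) (by linarith), sub_sub_cancel, hA, unif_ite_eq hπ, idealJump,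
    ENNReal.ofReal_add (by split_ifs <;> linarith [hπ.1]) (by split_ifs <;> linarith [hπ.2])]
  congr 3 <;> split_ifs <;> simp

/-- The mixture of staying, ideal jump and residual jump reassembles the two step matrix. Outside
the zone `stayProb` is 0 and the residual law is the whole row. -/
lemma walkKernel_rankJump (hq : 2 ≤ q) (hB : B < n / 2) (hg : ∀ d, Measurable (g d))
    (hgv : ∀ d x, volume (g d ⁻¹' {x}) = ENNReal.ofReal (residualJump q n B d x))
    (d x : Fin (n + 1)) :
    walkKernel jumpRandLaw (stayProb q n B) (rankJump q n B g) d x =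
      ENNReal.ofReal (rankP₂ q n d x) := by
  classical
  have hr := residualJump_nonneg hq hB d x
  have hs := stayProb_mem hq (B := B) d
  unfold walkKernel
  by_cases hd : inZone q n B d
  · have hη0 := failProb_pos hq (n := n) (B := B)
    have hη1 : failProb q n B ≤ 1 := hd.2
    have hs1 := one_sub_stayProb_pos hq hd
    have hi := idealJump_nonneg hq d x
    rw [measure_rankJump_of_inZone hq hg hgv hd, ← ENNReal.ofReal_mul hi,
      ← ENNReal.ofReal_mul hη0.le, ← ENNReal.ofReal_add (mul_nonneg hi (by linarith))
        (mul_nonneg hη0.le hr), ← ENNReal.ofReal_mul hs1.le]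
    by_cases hx : x = d
    · rw [if_pos hx, ← ENNReal.ofReal_add hs.1 (mul_nonneg hs1.le
        (add_nonneg (mul_nonneg hi (by linarith)) (mul_nonneg hη0.le hr))), residualJump,
        if_pos hd, if_pos hx]
      congr 1
      field_simp
      ring
    · rw [if_neg hx, zero_add, residualJump, if_pos hd, if_neg hx]
      congr 1
      field_simp
      ring
  · have e1 : stayProb q n B d = 0 := if_neg hd
    have e2 : {b | rankJump q n B g d b = x} = (Prod.snd : JumpRand → _) ⁻¹' (g d ⁻¹' {x}) := by
      ext b
      simp [rankJump, hd]
    have hmp : MeasurePreserving (Prod.snd : JumpRand → unitInterval) jumpRandLaw volume :=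
      measurePreserving_snd
    rw [e1, e2, hmp.measure_preimage (hg d (measurableSet_singleton x)).nullMeasurableSet, hgv,
      residualJump, if_neg hd]
    simp

end RankJump

/-! ### Bad instructions, and agreement of the two processes without them -/

lemma unif_Iic_le (x : ℝ) : unif (Iic x) ≤ ENNReal.ofReal x := by
  rw [unif, Measure.restrict_apply measurableSet_Iic]
  refine (measure_mono (t := Ioc 0 x) fun u hu => ⟨hu.2.1, hu.1⟩).trans ?_
  simp

lemma unif_Ici_le (x : ℝ) : unif (Ici x) ≤ ENNReal.ofReal (1 - x) := by
  rw [unif, Measure.restrict_apply measurableSet_Ici]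
  refine (measure_mono (t := Ico x 1) fun u hu => ⟨hu.1, hu.2.2⟩).trans ?_
  simp

/-- The instructions for which the coupling may break down at `x`. -/
def badInstr (q : ℝ) (n : ℕ) (B : ℝ) (x : HalfInt) : Set (ℝ × JumpRand) :=
  {p | p.1 ≤ q ^ (-(2 * B)) ∨ 1 - failProb q n B ≤ p.2.1.2 ∨ B < |(halfStep q x p.2 : ℝ)|}

section Event

variable {q : ℝ} {n : ℕ} {B : ℝ}

lemma measurableSet_badInstr (x : HalfInt) : MeasurableSet (badInstr q n B x) := by
  have h1 : MeasurableSet {p : ℝ × JumpRand | p.1 ≤ q ^ (-(2 * B))} :=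
    measurableSet_le measurable_fst measurable_const
  have h2 : MeasurableSet {p : ℝ × JumpRand | 1 - failProb q n B ≤ p.2.1.2} :=
    measurableSet_le measurable_const (measurable_snd.comp (measurable_fst.comp measurable_snd))
  have h3 : MeasurableSet {p : ℝ × JumpRand | B < |(halfStep q x p.2 : ℝ)|} :=
    ((measurable_halfStep x).comp measurable_snd)
      (Set.to_countable {y : HalfInt | B < |(y : ℝ)|}).measurableSet
  exact h1.union (h2.union h3)

lemma upProb_le (hq : 0 < q) (x : ℝ) : upProb q x ≤ q ^ (-(2 * x)) := by
  rw [upProb, div_le_iff₀ (totalRate_pos hq x), totalRate, mul_add, ← Real.rpow_add hq]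
  have : 0 < q ^ (-(2 * x)) * q ^ (-x) := by positivity
  rw [show -(2 * x) + x = -x by ring]
  linarith

lemma one_sub_upProb_le (hq : 0 < q) (x : ℝ) : 1 - upProb q x ≤ q ^ (2 * x) := by
  rw [one_sub_upProb hq, div_le_iff₀ (totalRate_pos hq x), totalRate, mul_add, ← Real.rpow_add hq,
    ← Real.rpow_add hq]
  have : 0 < q ^ (2 * x + x) := by positivity
  rw [show 2 * x + -x = x by ring]
  linarith

/-- Leaving `[-B, B]` requires an outward jump from within distance 1 of an end, which has
probability at most `q^{2-2B}` because of the drift towards 0. -/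
lemma measure_badInstr_le (hq : 1 ≤ q) {x : HalfInt} (hx : |(x : ℝ)| ≤ B) :
    (unif.prod jumpRandLaw) (badInstr q n B x) ≤
      ENNReal.ofReal (q ^ (-(2 * B))) + (ENNReal.ofReal (failProb q n B) +
        (ENNReal.ofReal (q ^ (2 - 2 * B)) + ENNReal.ofReal (q ^ (2 - 2 * B)))) := by
  have hq0 : 0 < q := by linarith
  obtain ⟨hx1, hx2⟩ := abs_le.1 hx
  have hmp1 : MeasurePreserving (Prod.fst : ℝ × JumpRand → ℝ) (unif.prod jumpRandLaw) unif :=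
    measurePreserving_fst
  have hmp2 : MeasurePreserving (fun p : ℝ × JumpRand => p.2.1.2) (unif.prod jumpRandLaw) unif :=
    measurePreserving_jumpRand_match.comp measurePreserving_snd
  have hmp3 : MeasurePreserving (fun p : ℝ × JumpRand => p.2.1.1) (unif.prod jumpRandLaw) unif :=
    measurePreserving_jumpRand_dir.comp measurePreserving_snd
  have hsub : badInstr q n B x ⊆ Prod.fst ⁻¹' Iic (q ^ (-(2 * B))) ∪
      ((fun p => p.2.1.2) ⁻¹' Ici (1 - failProb q n B) ∪
        ((fun p => p.2.1.1) ⁻¹' Iic (q ^ (2 - 2 * B)) ∪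
          (fun p => p.2.1.1) ⁻¹' Ici (1 - q ^ (2 - 2 * B)))) := by
    rintro p (hp | hp | hp)
    · exact Or.inl hp
    · exact Or.inr (Or.inl hp)
    · refine Or.inr (Or.inr ?_)
      unfold halfStep at hp
      split_ifs at hp with hu
      · left
        have h1 : B - 1 < x := by
          by_contra h
          refine absurd hp (not_lt.2 (abs_le.2 ?_))
          simp only [halfUp]
          constructor <;> linarith
        refine hu.le.trans ((upProb_le hq0 x).trans ?_)
        exact Real.rpow_le_rpow_of_exponent_le hq (by linarith)
      · right
        have h1 : (x : ℝ) < 1 - B := by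
          by_contra h
          refine absurd hp (not_lt.2 (abs_le.2 ?_))
          simp only [halfDown]
          constructor <;> linarith
        have h2 : 1 - upProb q x ≤ q ^ (2 - 2 * B) := (one_sub_upProb_le hq0 x).trans
          (Real.rpow_le_rpow_of_exponent_le hq (by linarith))
        change 1 - q ^ (2 - 2 * B) ≤ p.2.1.1
        linarith [not_lt.1 hu]
  refine (measure_mono hsub).trans ((measure_union_le _ _).trans (add_le_add ?_
    ((measure_union_le _ _).trans (add_le_add ?_ ((measure_union_le _ _).trans
      (add_le_add ?_ ?_))))))
  · rw [hmp1.measure_preimage measurableSet_Iic.nullMeasurableSet]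
    exact unif_Iic_le _
  · rw [hmp2.measure_preimage measurableSet_Ici.nullMeasurableSet]
    exact (unif_Ici_le _).trans (by rw [sub_sub_cancel])
  · rw [hmp3.measure_preimage measurableSet_Iic.nullMeasurableSet]
    exact unif_Iic_le _
  · rw [hmp3.measure_preimage measurableSet_Ici.nullMeasurableSet]
    exact (unif_Ici_le _).trans (by rw [sub_sub_cancel])

variable {g : Fin (n + 1) → unitInterval → Fin (n + 1)} {a : HalfInt} {x₀ : Fin (n + 1)} {N : ℕ}
  {ω : ℕ → ℝ × JumpRand}

lemma abs_halfStep_le_of_notMem_badInstr {x : HalfInt} {p : ℝ × JumpRand}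
    (hp : p ∉ badInstr q n B x) : |(halfStep q x p.2 : ℝ)| ≤ B :=
  not_lt.1 fun h => hp (Or.inr (Or.inr h))

lemma abs_jchain_le (ha : |(a : ℝ)| ≤ B)
    (hω : ω ∉ failSet (halfStep q) (badInstr q n B) N a) (i : ℕ) (hi : i ≤ N) :
    |((jchain (halfStep q) a ω i : HalfInt) : ℝ)| ≤ B :=
  jchain_mem_of_notMem_failSet (A := {x : HalfInt | |(x : ℝ)| ≤ B})
    (fun _ _ _ hp => abs_halfStep_le_of_notMem_badInstr hp) ha hω i hi

lemma jchain_rankJump_eq (hB : B < n / 2) (hη : failProb q n B ≤ 1) (ha : |(a : ℝ)| ≤ B)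
    (hx₀ : (x₀ : ℝ) - n / 2 = a)
    (hω : ω ∉ failSet (halfStep q) (badInstr q n B) N a) (i : ℕ) (hi : i ≤ N) :
    ((jchain (rankJump q n B g) x₀ ω i : Fin (n + 1)) : ℝ) - n / 2 =
      (jchain (halfStep q) a ω i : HalfInt) := by
  induction i with
  | zero => exact hx₀
  | succ i ih =>
    have ih := ih (by omega)
    have hA := abs_jchain_le ha hω i (by omega)
    have hb : ω i ∉ badInstr q n B (jchain (halfStep q) a ω i) := fun h => hω ⟨i, by omega, h⟩
    have hm : (ω i).2.1.2 < 1 - failProb q n B := not_le.1 fun h => hb (Or.inr (Or.inl h))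
    rw [← ih] at hA
    have hd : inZone q n B (jchain (rankJump q n B g) x₀ ω i) := ⟨hA, hη⟩
    rw [jchain, jchain, rankJump, if_pos ⟨hd, hm⟩, halfStep, ih]
    split_ifs
    · rw [finUp_val hB hd, halfUp]
      push_cast
      rw [← ih]
      ring
    · have h := finDown_val hB hd
      have h : ((finDown (jchain (rankJump q n B g) x₀ ω i) : ℕ) : ℝ) + 1 =
        (jchain (rankJump q n B g) x₀ ω i : Fin (n + 1)) := by exact_mod_cast h
      simp only [halfDown]
      rw [← ih]
      linarith

/-- Each holding time contributes an error of at most `δ (1 - log u)`, and `-log u < 2B log q`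
because `u > q^{-2B}` on the good event. -/
lemma rescaled_jumpTime (hq : 2 ≤ q) (hB : B < n / 2) (hη : failProb q n B ≤ 1)
    (ha : |(a : ℝ)| ≤ B) (hx₀ : (x₀ : ℝ) - n / 2 = a)
    (hgood : ω ∈ goodInstr (fun x : HalfInt => totalRate q x) (halfStep q) a)
    (hω : ω ∉ failSet (halfStep q) (badInstr q n B) N a) {X : ℕ → Fin (n + 1)}
    (hX : ∀ k, X (2 * k) = walk (stayProb q n B) (rankJump q n B g) k x₀ (headTail ω))
    (i : ℕ) (hi : i ≤ N) :
    embedded (rescaled q n X) i = (jchain (halfStep q) a ω i : HalfInt) ∧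
      ∃ R : ℝ, 0 ≤ R ∧ jumpTime (rescaled q n X) i = (R.toNNReal : ℝ≥0∞) ∧
        |R - jtime (fun x : HalfInt => totalRate q x) (halfStep q) a ω i| ≤
          i * (cellLen q n * (1 + 2 * B * Real.log q)) := by
  have hq0 : 0 < q := by linarith
  have hδ := cellLen_pos (n := n) hq
  have hB0 : 0 ≤ B := (abs_nonneg _).trans ha
  set D := jchain (rankJump q n B g) x₀ ω with hD
  have hDZ : ∀ i ≤ N, ((D i : ℕ) : ℝ) - n / 2 = (jchain (halfStep q) a ω i : HalfInt) :=
    fun i hi => jchain_rankJump_eq hB hη ha hx₀ hω i hi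
  have hzone : ∀ i ≤ N, inZone q n B (D i) := fun i hi => by
    refine ⟨?_, hη⟩
    rw [hDZ i hi]
    exact abs_jchain_le ha hω i hi
  have hs : ∀ i ≤ N, stayProb q n B (D i) =
      1 - cellLen q n * totalRate q (jchain (halfStep q) a ω i : HalfInt) := fun i hi => by
    rw [stayProb_of_inZone (hzone i hi), hDZ i hi]
  have hx : ∀ i ≤ N, cellLen q n * totalRate q (jchain (halfStep q) a ω i : HalfInt) < 1 := fun i hi => by
    rw [← hDZ i hi]
    exact cellLen_mul_totalRate_lt hq (hzone i hi)
  have hs0 : ∀ i < N, 0 < stayProb q n B (D i) := fun i hi => by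
    rw [hs i hi.le]; linarith [hx i hi.le]
  have hs1 : ∀ i < N, stayProb q n B (D i) < 1 := fun i hi => by
    rw [hs i hi.le]
    have := mul_pos hδ (totalRate_pos hq0 ((jchain (halfStep q) a ω i : HalfInt) : ℝ))
    linarith
  have hGex : ∀ i, ∃ G : ℕ, i < N → (ω i).1 < stayProb q n B (D i) ^ G ∧
      stayProb q n B (D i) ^ (G + 1) ≤ (ω i).1 := by
    intro i
    by_cases hi : i < N
    · obtain ⟨G, hG⟩ := exists_pow_le_lt (hs1 i hi) (hgood.1 i).1 (hgood.1 i).2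
      exact ⟨G, fun _ => hG⟩
    · exact ⟨0, fun h => absurd h hi⟩
  choose G hG using hGex
  set σ : ℕ → ℕ := fun i => ∑ j ∈ Finset.range i, (G j + 1) with hσ
  have hσs : ∀ i, σ (i + 1) = σ i + (G i + 1) := fun i => Finset.sum_range_succ _ _
  have hW : ∀ i < N, ∀ m ≤ G i,
      walk (stayProb q n B) (rankJump q n B g) (σ i + m) x₀ (headTail ω) = D i := fun i hi m hm =>
    walk_sum_add_eq hs0 hs1 (fun i hi => (hG i hi).1) (fun i hi => (hG i hi).2) i hi m hm
  have hWσ : ∀ i ≤ N, walk (stayProb q n B) (rankJump q n B g) (σ i) x₀ (headTail ω) = D i :=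
    fun i hi => walk_sum_add hs0 hs1 (fun i hi => (hG i hi).1) (fun i hi => (hG i hi).2) i hi 0
  set F : ℕ → ℝ := fun m =>
    ((walk (stayProb q n B) (rankJump q n B g) m x₀ (headTail ω) : Fin (n + 1)) : ℝ) - n / 2
    with hF
  have hFσ : ∀ i ≤ N, F (σ i) = (jchain (halfStep q) a ω i : HalfInt) := fun i hi => by
    rw [← hDZ i hi, hF]
    simp only [hWσ i hi]
  have hY : rescaled q n X = fun t : ℝ≥0 => F ⌊q ^ ((n : ℝ) / 2) * (q - 1) * (t : ℝ)⌋₊ := by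
    funext t
    rw [rescaled, hX]
  have hc : 0 < q ^ ((n : ℝ) / 2) * (q - 1) := mul_pos (by positivity) (by linarith)
  have hcδ : ∀ y : ℝ, y / (q ^ ((n : ℝ) / 2) * (q - 1)) = cellLen q n * y := fun y => by
    rw [cellLen, neg_div, Real.rpow_neg hq0.le]
    field_simp
  obtain ⟨h1, h2⟩ := jumpTime_floor (F := F) hc (σ := σ) (N := N) (by simp [hσ])
    (fun i _ => by rw [hσs]; omega)
    (fun i hi m hm1 hm2 => by
      rw [hσs] at hm2
      obtain ⟨m', rfl⟩ := Nat.exists_eq_add_of_le hm1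
      simp only [hF]
      rw [hW i hi m' (by omega), hWσ i hi.le])
    (fun i hi => by
      rw [hFσ (i + 1) hi, hFσ i hi.le]
      exact fun h => halfStep_ne _ _ (Subtype.ext h)) i hi
  rw [hY]
  refine ⟨by rw [h2, hFσ i hi], σ i / (q ^ ((n : ℝ) / 2) * (q - 1)), by positivity, h1, ?_⟩
  rw [hcδ, hσ, jtime, Nat.cast_sum, Finset.mul_sum, ← Finset.sum_sub_distrib]
  refine (Finset.abs_sum_le_sum_abs _ _).trans ((Finset.sum_le_card_nsmul _ _ _ fun j hj => ?_).trans
    (by rw [Finset.card_range, nsmul_eq_mul]))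
  have hj : j < N := (Finset.mem_range.1 hj).trans_le hi
  have hGj := hG j hj
  rw [hs j hj.le] at hGj
  refine (abs_geom_sub_exp_le hδ (totalRate_pos hq0 _) (hx j hj.le) (hgood.1 j).1 hGj.1
    hGj.2).trans (mul_le_mul_of_nonneg_left ?_ hδ.le)
  have hu : q ^ (-(2 * B)) < (ω j).1 := not_le.1 fun h => hω ⟨j, hj, Or.inl h⟩
  have := Real.log_lt_log (by positivity) hu
  rw [Real.log_rpow hq0] at this
  linarith

end Event

/-! ### Numerical estimates for `B = 4n/25` -/

/-- The exponent `13/50` is what the time budget leaves: `4/25 - 1/2 + 13/50 = -2/25`. -/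
lemma one_add_le_rpow {q : ℝ} (hq : 2 ≤ q) {n : ℕ} (hη : failProb q n (4 / 25 * n) ≤ 1) :
    1 + 2 * (4 / 25 * n) * Real.log q ≤ q ^ ((13 / 50 : ℝ) * n) := by
  have hq0 : 0 < q := by linarith
  have h6 : 6 ≤ Real.exp ((17 / 50 : ℝ) * (n * Real.log q)) := by
    have h1 : 3 * q ≤ q ^ ((17 / 50 : ℝ) * n) := by
      rw [failProb, show -(n : ℝ) / 2 + 4 / 25 * n = -(17 / 50 * n) by ring, Real.rpow_neg hq0.le,
        mul_inv_le_iff₀ (by positivity)] at hη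
      linarith
    rw [Real.rpow_def_of_pos hq0] at h1
    refine le_trans (by linarith) (h1.trans_eq ?_)
    congr 1
    ring
  rw [Real.rpow_def_of_pos hq0, show Real.log q * (13 / 50 * n) = 13 / 50 * (n * Real.log q) by ring,
    show 1 + 2 * (4 / 25 * (n : ℝ)) * Real.log q = 1 + 8 / 25 * (n * Real.log q) by ring]
  set L := (n : ℝ) * Real.log q with hL
  -- The inequality fails for small positive `L`, but `failProb ≤ 1` excludes that range; `9/5` is
  -- just enough for the quadratic lower bound of the exponential.
  have hL2 : 9 / 5 ≤ L := by
    by_contra h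
    have h1 : Real.exp ((17 / 50 : ℝ) * L) ≤ Real.exp 1 := Real.exp_le_exp.2 (by linarith)
    linarith [Real.exp_one_lt_d9]
  have := Real.quadratic_le_exp_of_nonneg (show 0 ≤ 13 / 50 * L by linarith)
  nlinarith

lemma mul_cellLen_le {q : ℝ} (hq : 2 ≤ q) {n : ℕ} (hη : failProb q n (4 / 25 * n) ≤ 1) {i : ℝ}
    (hi : i ≤ q ^ ((4 / 25 : ℝ) * n)) :
    i * (cellLen q n * (1 + 2 * (4 / 25 * n) * Real.log q)) ≤ q ^ (-((2 / 25 : ℝ) * n)) := by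
  have hq0 : 0 < q := by linarith
  have hlog : 0 ≤ Real.log q := Real.log_nonneg (by linarith)
  calc i * (cellLen q n * (1 + 2 * (4 / 25 * n) * Real.log q))
      ≤ q ^ ((4 / 25 : ℝ) * n) * (q ^ (-(n : ℝ) / 2) * q ^ ((13 / 50 : ℝ) * n)) := by
        have := cellLen_pos (n := n) hq
        gcongr
        · exact cellLen_le hq
        · exact one_add_le_rpow hq hη
    _ = q ^ (-((2 / 25 : ℝ) * n)) := by
        rw [← Real.rpow_add hq0, ← Real.rpow_add hq0]
        congr 1
        ring

/-- The constant in the bound for the lower tail of the jump times. -/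
noncomputable def tailConst (ε : ℝ) : ℝ := 8 / ε ^ 2 * Real.exp (ε + 1 / (2 * ε))

lemma exp_mul_pow_mul_le {ε y : ℝ} (hε : 0 < ε) (hε1 : ε < 1) (hy : 1 ≤ y) :
    Real.exp y * ((1 - ε) ^ ⌊y ^ 2⌋₊ * y) ≤ tailConst ε * (y ^ 2)⁻¹ := by
  have hy0 : 0 < y := by linarith
  have hN : y ^ 2 - 1 ≤ ⌊y ^ 2⌋₊ := (Nat.sub_one_lt_floor _).le
  have h1 : (1 - ε) ^ ⌊y ^ 2⌋₊ ≤ Real.exp (-ε * (y ^ 2 - 1)) := by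
    calc (1 - ε) ^ ⌊y ^ 2⌋₊ ≤ Real.exp (-ε) ^ ⌊y ^ 2⌋₊ :=
          pow_le_pow_left₀ (by linarith) (Real.one_sub_le_exp_neg ε) _
      _ = Real.exp (-ε * ⌊y ^ 2⌋₊) := by rw [← Real.exp_nat_mul]; ring_nf
      _ ≤ _ := Real.exp_le_exp.2 (by nlinarith)
  -- Half of the decay `exp(-ε y²)` absorbs `exp y`, the other half absorbs `y³`.
  have h2 : y ≤ ε * y ^ 2 / 2 + 1 / (2 * ε) := by
    have : ε * y ^ 2 / 2 + 1 / (2 * ε) - y = (ε * y - 1) ^ 2 / (2 * ε) := by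
      field_simp
      ring
    have h3 : 0 ≤ (ε * y - 1) ^ 2 / (2 * ε) := by positivity
    linarith
  have h4 : y ^ 3 ≤ 8 / ε ^ 2 * Real.exp (ε * y ^ 2 / 2) := by
    have h5 := Real.quadratic_le_exp_of_nonneg (show 0 ≤ ε * y ^ 2 / 2 by positivity)
    have h6 : ε ^ 2 * y ^ 4 / 8 ≤ Real.exp (ε * y ^ 2 / 2) := by
      have : 0 ≤ ε * y ^ 2 / 2 := by positivity
      nlinarith
    have h7 : y ^ 3 ≤ y ^ 4 := pow_le_pow_right₀ hy (by norm_num)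
    rw [div_mul_eq_mul_div, le_div_iff₀ (by positivity)]
    nlinarith [pow_pos hε 2]
  rw [← div_eq_mul_inv, le_div_iff₀ (by positivity)]
  calc Real.exp y * ((1 - ε) ^ ⌊y ^ 2⌋₊ * y) * y ^ 2
      = Real.exp y * (1 - ε) ^ ⌊y ^ 2⌋₊ * y ^ 3 := by ring
    _ ≤ Real.exp (ε * y ^ 2 / 2 + 1 / (2 * ε)) * Real.exp (-ε * (y ^ 2 - 1)) *
          (8 / ε ^ 2 * Real.exp (ε * y ^ 2 / 2)) := by
        have : 0 ≤ 1 - ε := by linarith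
        gcongr
    _ = tailConst ε := by
        rw [tailConst, mul_left_comm, ← Real.exp_add, ← Real.exp_add]
        congr 2
        ring

/-! ### The coupling event and the theorem -/

section Final

variable {q : ℝ} {n : ℕ}

/-- The constant of the main theorem. -/
noncomputable def couplingConst (q : ℝ) : ℝ := 1 + 3 * q + 2 * q ^ 2 + tailConst (gap q)

/-- The event on which the coupling succeeds. -/
def couplingEvent (q : ℝ) (n : ℕ) (B : ℝ) (a : HalfInt) : Set (ℕ → ℝ × JumpRand) :=
  goodInstr (fun x : HalfInt => totalRate q x) (halfStep q) a ∩
    ((failSet (halfStep q) (badInstr q n B) ⌊q ^ B⌋₊ a)ᶜ ∩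
      {ω | q ^ (B / 2) ≤ jtime (fun x : HalfInt => totalRate q x) (halfStep q) a ω ⌊q ^ B⌋₊})

lemma measurableSet_couplingEvent (B : ℝ) (a : HalfInt) :
    MeasurableSet (couplingEvent q n B a) :=
  (measurableSet_goodInstr measurable_halfStep a).inter
    ((measurableSet_failSet measurable_halfStep measurableSet_badInstr _ a).compl.inter
      (measurableSet_le measurable_const (measurable_jtime measurable_halfStep a _)))

lemma ae_mem_goodInstr_halfStep (hq : 1 < q) (a : HalfInt) :
    ∀ᵐ ω ∂(instrLaw jumpRandLaw),
      ω ∈ goodInstr (fun x : HalfInt => totalRate q x) (halfStep q) a := by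
  refine ae_mem_goodInstr (h := fun x : HalfInt => ENNReal.ofReal (q ^ (|(x : ℝ)| / 2)))
    (ρ := ENNReal.ofReal (1 - gap q)) (fun x => totalRate_pos (by linarith) _) measurable_halfStep
    (one_le_ofReal_rpow_abs hq) ?_ (halfStep_lyapunov hq) ENNReal.ofReal_ne_top
  rw [ENNReal.ofReal_lt_one]
  linarith [gap_pos hq]

lemma natCast_mul_failure_le (hq : 2 ≤ q) {N : ℕ} (hN : (N : ℝ) ≤ q ^ ((4 / 25 : ℝ) * n)) :
    N * (q ^ (-(2 * ((4 / 25 : ℝ) * n))) + (failProb q n (4 / 25 * n) +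
      (q ^ (2 - 2 * ((4 / 25 : ℝ) * n)) + q ^ (2 - 2 * ((4 / 25 : ℝ) * n))))) ≤
        (1 + 3 * q + 2 * q ^ 2) * q ^ (-((4 / 25 : ℝ) * n)) := by
  have hq0 : 0 < q := by linarith
  have hη := failProb_pos hq (n := n) (B := 4 / 25 * n)
  refine (mul_le_mul_of_nonneg_right hN (by positivity)).trans ?_
  set B : ℝ := 4 / 25 * n with hB
  have e1 : q ^ B * q ^ (-(2 * B)) = q ^ (-B) := by rw [← Real.rpow_add hq0]; congr 1; ring
  have e2 : q ^ B * q ^ (2 - 2 * B) = q ^ 2 * q ^ (-B) := by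
    rw [← Real.rpow_add hq0, ← Real.rpow_natCast, ← Real.rpow_add hq0]; congr 1; push_cast; ring
  -- This uses `3B ≤ n/2`, that is, `0.48 ≤ 0.5`: the tightest constraint on `α` in the failure
  -- bound.
  have e3 : q ^ B * q ^ (-(n : ℝ) / 2 + B) ≤ q ^ (-B) := by
    rw [← Real.rpow_add hq0]
    refine Real.rpow_le_rpow_of_exponent_le (by linarith) ?_
    have : (0 : ℝ) ≤ n := Nat.cast_nonneg n
    rw [hB]
    linarith
  have e4 : q ^ B * failProb q n B ≤ 3 * q * q ^ (-B) := by
    rw [failProb, mul_left_comm]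
    exact mul_le_mul_of_nonneg_left e3 (by linarith)
  rw [mul_add, mul_add, mul_add, e1, e2]
  linarith

lemma measure_compl_couplingEvent_le (hq : 2 ≤ q) {a : HalfInt}
    (ha : |(a : ℝ)| ≤ (4 / 25 : ℝ) * n) :
    instrLaw jumpRandLaw (couplingEvent q n (4 / 25 * n) a)ᶜ ≤
      ENNReal.ofReal (couplingConst q * q ^ (-((4 / 25 : ℝ) * n))) := by
  have hq0 : 0 < q := by linarith
  have hq1 : 1 < q := by linarith
  set B : ℝ := 4 / 25 * n with hB
  have hB0 : 0 ≤ B := by positivity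
  have hg := gap_pos hq1
  have hg1 := gap_lt_one hq1
  set N := ⌊q ^ B⌋₊ with hN
  have hNle : (N : ℝ) ≤ q ^ B := Nat.floor_le (by positivity)
  have hη := failProb_pos hq (n := n) (B := B)
  have hfail : instrLaw jumpRandLaw (failSet (halfStep q) (badInstr q n B) N a) ≤
      ENNReal.ofReal ((1 + 3 * q + 2 * q ^ 2) * q ^ (-B)) := by
    refine (measure_failSet_le measurable_halfStep measurableSet_badInstr
      (A := {x : HalfInt | |(x : ℝ)| ≤ B}) (fun _ _ _ hp => abs_halfStep_le_of_notMem_badInstr hp)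
      (fun x hx => measure_badInstr_le hq1.le hx) N a ha).trans ?_
    rw [← ENNReal.ofReal_add (by positivity) (by positivity),
      ← ENNReal.ofReal_add (by positivity) (by positivity),
      ← ENNReal.ofReal_add (by positivity) (by positivity), ← ENNReal.ofReal_natCast,
      ← ENNReal.ofReal_mul (by positivity)]
    exact ENNReal.ofReal_le_ofReal (natCast_mul_failure_le hq hNle)
  have hsq : (q ^ (B / 2)) ^ 2 = q ^ B := by
    rw [← Real.rpow_natCast, ← Real.rpow_mul hq0.le]
    congr 1
    push_cast
    ring
  have htail : instrLaw jumpRandLaw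
      {ω | jtime (fun x : HalfInt => totalRate q x) (halfStep q) a ω N < q ^ (B / 2)} ≤
        ENNReal.ofReal (tailConst (gap q) * q ^ (-B)) := by
    refine (measure_jtime_lt_le (h := fun x : HalfInt => ENNReal.ofReal (q ^ (|(x : ℝ)| / 2)))
      (ρ := ENNReal.ofReal (1 - gap q)) (fun x => totalRate_pos hq0 _) measurable_halfStep
      (one_le_ofReal_rpow_abs hq1) (halfStep_lyapunov hq1) N a (q ^ (B / 2))).trans ?_
    rw [← ENNReal.ofReal_pow (by linarith), ← ENNReal.ofReal_mul (by positivity),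
      ← ENNReal.ofReal_mul (by positivity)]
    refine ENNReal.ofReal_le_ofReal ?_
    -- Here `y = q^{B/2}` plays three roles: it is the time threshold, `⌊y²⌋` is the number of
    -- jumps, and `y` bounds the Lyapunov function at `a` because `|a| ≤ B`.
    have h := exp_mul_pow_mul_le hg hg1 (Real.one_le_rpow hq1.le (show 0 ≤ B / 2 by positivity))
    rw [hsq, ← hN, ← Real.rpow_neg hq0.le] at h
    refine le_trans ?_ h
    have : 0 ≤ 1 - gap q := by linarith
    gcongr
    exact hq1.le
  have hgood : instrLaw jumpRandLaw
      (goodInstr (fun x : HalfInt => totalRate q x) (halfStep q) a)ᶜ = 0 :=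
    ae_mem_goodInstr_halfStep hq1 a
  have htc : 0 ≤ tailConst (gap q) := by unfold tailConst; positivity
  have hsub : (couplingEvent q n B a)ᶜ ⊆
      (goodInstr (fun x : HalfInt => totalRate q x) (halfStep q) a)ᶜ ∪
        (failSet (halfStep q) (badInstr q n B) N a ∪
          {ω | jtime (fun x : HalfInt => totalRate q x) (halfStep q) a ω N < q ^ (B / 2)}) := by
    intro ω hω
    by_contra h
    simp only [mem_union, not_or, mem_ofPred_eq, not_lt, mem_compl_iff, not_not] at h
    exact hω ⟨h.1, h.2.1, h.2.2⟩
  refine (measure_mono hsub).trans ((measure_union_le _ _).trans ?_)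
  rw [hgood, zero_add]
  refine (measure_union_le _ _).trans ((add_le_add hfail htail).trans_eq ?_)
  rw [← ENNReal.ofReal_add (by positivity) (by positivity), couplingConst]
  congr 1
  ring

lemma exists_start (hn : Odd n) {a : HalfInt} (ha : |(a : ℝ)| ≤ (4 / 25 : ℝ) * n) :
    ∃ x₀ : Fin (n + 1), ((x₀ : ℕ) : ℝ) - (n : ℝ) / 2 = a := by
  obtain ⟨m, rfl⟩ := hn
  obtain ⟨k, hk⟩ := a.2
  rw [hk] at ha ⊢
  obtain ⟨h1, h2⟩ := abs_le.1 ha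
  push_cast at h1 h2
  have hm : (0 : ℝ) ≤ m := Nat.cast_nonneg m
  -- With `a = k + 1/2` and `n = 2m + 1`, the starting state `a + n/2` is `k + m + 1`.
  have h3 : (-1 : ℝ) < (k + m + 1 : ℤ) := by push_cast; linarith
  have h4 : ((k + m + 1 : ℤ) : ℝ) < (2 * m + 2 : ℤ) := by push_cast; linarith
  have h3' : -1 < k + m + 1 := by exact_mod_cast h3
  have h4' : k + m + 1 < 2 * m + 2 := by exact_mod_cast h4
  have h5 : (((k + m + 1).toNat : ℕ) : ℤ) = k + m + 1 := Int.toNat_of_nonneg (by omega)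
  refine ⟨⟨(k + m + 1).toNat, by omega⟩, ?_⟩
  have h6 : (((k + m + 1).toNat : ℕ) : ℝ) = k + m + 1 := by exact_mod_cast h5
  simp only [h6]
  push_cast
  ring

end Final

theorem mainTheorem10 (q : ℕ) (hq : IsPrimePow q) (α : ℝ) (hα : α = 0.08) :
    ∃ C : ℝ, ∀ n : ℕ, Odd n → ∀ a : HalfInt, |(a : ℝ)| ≤ 2 * α * n →
      -- the starting point `x₀ = a + n / 2` of the chain, so that `Y_0 = a`
      ∃ x₀ : Fin (n + 1), ((x₀ : ℕ) : ℝ) - (n : ℝ) / 2 = (a : ℝ) ∧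
      -- the coupling
      ∃ (Ω : Type) (_ : MeasurableSpace Ω) (μ : Measure Ω) (_ : IsProbabilityMeasure μ)
        (X : ℕ → Ω → Fin (n + 1)) (Z : ℝ≥0 → Ω → HalfInt),
        IsDiscreteMarkovChain μ (rankP q n) x₀ X ∧
        IsMarkovJumpProcess μ (oddRate q) a Z ∧
        ∃ E : Set Ω, MeasurableSet E ∧
          1 - C * (q : ℝ) ^ (-(2 * α * n)) ≤ μ.real E ∧
          ∀ ω ∈ E,
            let Yω : ℝ≥0 → ℝ := rescaled q n (fun i => X i ω)
            let Zω : ℝ≥0 → HalfInt := fun t => Z t ω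
            (∀ i : ℕ, (i : ℝ) ≤ (q : ℝ) ^ (2 * α * n) →
              embedded Yω i = (embedded Zω i).val) ∧
            (∀ i : ℕ, (i : ℝ) ≤ (q : ℝ) ^ (2 * α * n) →
              jumpTime Yω i ≠ ∞ ∧ jumpTime Zω i ≠ ∞ ∧
              |(jumpTime Yω i).toReal - (jumpTime Zω i).toReal| ≤ (q : ℝ) ^ (-(α * n))) ∧
            ENNReal.ofReal ((q : ℝ) ^ (α * n)) ≤ jumpTime Zω ⌊(q : ℝ) ^ (2 * α * n)⌋₊ := by
  have hq2 : (2 : ℝ) ≤ q := by exact_mod_cast hq.two_le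
  have hq0 : (0 : ℝ) < q := by linarith
  have hq1 : (1 : ℝ) < q := by linarith
  -- From here on `q` is an arbitrary real number at least 2.
  generalize (q : ℝ) = q at *
  refine ⟨couplingConst q, fun n hn a ha => ?_⟩
  have e1 : 2 * α * n = 4 / 25 * n := by rw [hα]; norm_num
  have e2 : α * n = 2 / 25 * n := by rw [hα]; norm_num
  rw [e1] at ha ⊢
  rw [e2]
  have hn0 : (0 : ℝ) < n := by exact_mod_cast hn.pos
  have hB : (4 / 25 : ℝ) * n < n / 2 := by linarith
  obtain ⟨x₀, hx₀⟩ := exists_start hn ha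
  have hrate : ∀ x : HalfInt, 0 < totalRate q x := fun x => totalRate_pos hq0 x
  choose g hg hgv using fun d => exists_measurable_of_weights
    (residualJump_nonneg (n := n) (B := 4 / 25 * n) hq2 hB d) (sum_residualJump hq2 d)
  have hW := walk_isDiscreteMarkovChain jumpRandLaw (stayProb_mem hq2) (measurable_rankJump hg)
    (rankP₂_nonneg hq1 n) (walkKernel_rankJump hq2 hB hg hgv) x₀
  obtain ⟨X, hX, hXW⟩ := exists_bridge (rankP_nonneg hq1 n) (sum_rankP hq1 n) hW fun _ => rfl
  refine ⟨x₀, hx₀, _, _, (instrLaw jumpRandLaw).prod (Measure.infinitePi fun _ => volume),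
    inferInstance, X, fun t p => jpath (fun x : HalfInt => totalRate q x) (halfStep q) a t p.1, hX,
    jpath_isMarkovJumpProcess jumpRandLaw hrate measurable_halfStep halfStep_ne oddRate_self
      (measureReal_halfStep_eq hq0) a (ae_mem_goodInstr_halfStep hq1 a) measurePreserving_fst, ?_⟩
  -- If `failProb` exceeds 1, then `C q^{-B} ≥ 1` by the choice of the constant, and the empty event
  -- suffices.
  by_cases hη : failProb q n (4 / 25 * n) ≤ 1
  swap
  · refine ⟨∅, MeasurableSet.empty, ?_, fun _ h => absurd h (notMem_empty _)⟩
    have hC : 3 * q ≤ couplingConst q := by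
      have : 0 ≤ tailConst (gap q) := by unfold tailConst; positivity
      unfold couplingConst
      nlinarith
    have h1 : (q : ℝ) ^ (-(n : ℝ) / 2 + 4 / 25 * n) ≤ q ^ (-((4 / 25 : ℝ) * n)) :=
      Real.rpow_le_rpow_of_exponent_le hq1.le (by linarith)
    have h2 : 1 < 3 * q * q ^ (-(n : ℝ) / 2 + 4 / 25 * n) := not_le.1 hη
    have h3 : 3 * q * q ^ (-(n : ℝ) / 2 + 4 / 25 * n) ≤
        couplingConst q * q ^ (-((4 / 25 : ℝ) * n)) :=
      mul_le_mul hC h1 (by positivity) (by linarith)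
    rw [measureReal_empty]
    linarith
  have hEm := measurableSet_couplingEvent (q := q) (n := n) (4 / 25 * n) a
  refine ⟨couplingEvent q n (4 / 25 * n) a ×ˢ univ, hEm.prod MeasurableSet.univ, ?_, ?_⟩
  · have h := measure_compl_couplingEvent_le hq2 ha
    have htc : 0 ≤ couplingConst q * q ^ (-((4 / 25 : ℝ) * n)) := by
      unfold couplingConst tailConst
      positivity
    have h' := ENNReal.toReal_mono ENNReal.ofReal_ne_top h
    rw [ENNReal.toReal_ofReal htc, ← Measure.real, probReal_compl_eq_one_sub hEm] at h'
    rw [measureReal_prod_prod, probReal_univ, mul_one]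
    linarith
  · rintro ⟨ω, v⟩ ⟨⟨hgood, hfail, htime⟩, -⟩
    intro Yω Zω
    have hN : ∀ i : ℕ, (i : ℝ) ≤ q ^ ((4 / 25 : ℝ) * n) → i ≤ ⌊q ^ ((4 / 25 : ℝ) * n)⌋₊ :=
      fun i hi => Nat.le_floor hi
    have hY := rescaled_jumpTime hq2 hB hη ha hx₀ hgood hfail (X := fun i => X i (ω, v))
      (fun k => hXW k (ω, v))
    have hZ := jumpTime_jpath hrate halfStep_ne hgood
    refine ⟨fun i hi => ?_, fun i hi => ?_, ?_⟩
    · rw [(hY i (hN i hi)).1]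
      exact congrArg Subtype.val (embedded_jpath hrate halfStep_ne hgood i).symm
    · obtain ⟨-, R, hR0, hR, hRT⟩ := hY i (hN i hi)
      have hT := jtime_nonneg hrate hgood i
      refine ⟨hR ▸ ENNReal.coe_ne_top, (hZ i).symm ▸ ENNReal.coe_ne_top, ?_⟩
      have hR' : (jumpTime Yω i).toReal = R := by
        rw [hR, ENNReal.coe_toReal, Real.coe_toNNReal _ hR0]
      have hZ' : (jumpTime Zω i).toReal =
          jtime (fun x : HalfInt => totalRate q x) (halfStep q) a ω i := by
        rw [hZ i, ENNReal.coe_toReal, Real.coe_toNNReal _ hT]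
      rw [hR', hZ']
      exact hRT.trans (mul_cellLen_le hq2 hη hi)
    · rw [hZ]
      refine ENNReal.coe_le_coe.2 (Real.toNNReal_le_toNNReal ?_)
      refine le_of_eq_of_le ?_ htime
      congr 1
      ring
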